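/- Let $F\subset\mathbb{P}^2(\mathbb{C})$ be the Fermat cubic $x^3+y^3+z^3=0$, with the chord-and-tangent group law whose neutral element is the flex $[1:-1:0]$. Call a point $P\in F$ a type-$9$ point if $P$ is not a flex of $F$ and there is an irreducible plane cubic that meets $F$ at $P$ with intersection multiplicity exactly $9$. Let $\alpha\in\mathbb{C}$ with $\alpha^3=3$ and let $\beta\in\mathbb{C}$ be a primitive $9$th root of unity. Then: 1. every type-$9$ point of $F$ has homogeneous coordinates in the field $\mathbb{Q}(\alpha,\beta)$; 2. there are exactly $72$ type-$9$ points on $F$; 3. the type-$9$ points are exactly the points $P\in F$ with $9P=0$ and $3P\neq 0$; 4. the type-$9$ points are exactly the points obtained by permuting the homogeneous coordinates of the following twelve points: \begin{align*} T_1 &= [1 : \beta : \beta^2], \\ T_2 &= [1 : \beta^2 : \beta^4], \\ T_3 &= [1 : \beta : \beta^5], \\ T_4 &= [3 : \alpha\beta(\beta^4 + 2 \beta^3 - \beta + 1) : -\alpha^2(\beta^2 + \beta + 1)(\beta^3 - \beta + 1)], \\ T_5 &= [3 : -\alpha\beta(2\beta^4 + \beta^3 + \beta + 2) : \alpha^2(\beta+1)(\beta-1)^2],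 \\ T_6 &= [3 : \alpha\beta(\beta^4 - \beta^3 - \beta - 2) : -\alpha^2\beta^2(\beta^2 + \beta + 1)], \\ T_7 &= [3 : \alpha\beta(\beta - 1)(\beta^3 + 2) : -\alpha^2\beta(\beta^2 + \beta + 1)(\beta^2 - \beta + 1)], \\ T_8 &= [3 : \alpha^2(\beta - 1)(\beta + 1)(\beta^3 + \beta + 1) : \alpha\beta(\beta^4 - \beta^3 - \beta - 2)], \\ T_9 &= [3 : \alpha\beta(\beta-1)^2(\beta^2 + \beta + 1) : -\alpha^2\beta(\beta^2 + \beta + 1)(\beta^2 - \beta + 1)], \\ T_{10} &= [3 : \alpha\beta(\beta - 1)^2(\beta^2 + \beta + 1) : \alpha^2(\beta - 1)(\beta^3 + \beta^2 + 1)], \\ T_{11} &= [3 : \alpha\beta(\beta^4 + 2\beta^3 + 2\beta + 1) : -\alpha^2\beta^2(\beta^2 + \beta + 1)], \\ T_{12} &= [3 : -\alpha^2(\beta^2 + \beta + 1)(\beta^3 - \beta + 1) : -\alpha\beta(2\beta^4 + \beta^3 + \beta + 2)]. \end{align*} -/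

import Mathlib

noncomputable section

open MvPolynomial

/-- The complex projective plane `ℙ²(ℂ)`. -/
abbrev ProjPlane : Type := Projectivization ℂ (Fin 3 → ℂ)

/-- `v` is a vector of homogeneous coordinates of `P`, i.e. `P = [v 0 : v 1 : v 2]`. -/
def HasCoords (P : ProjPlane) (v : Fin 3 → ℂ) : Prop :=
  ∃ hv : v ≠ 0, Projectivization.mk ℂ v hv = P

/-- The point `P` lies on the plane curve with (homogeneous) equation `C = 0`. -/
def OnCurve (C : MvPolynomial (Fin 3) ℂ) (P : ProjPlane) : Prop :=
  eval P.rep C = 0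

/-! ### Intersection multiplicity -/

/-- The maximal ideal of `ℂ[X₀, X₁]` of all polynomials vanishing at the point `p ∈ ℂ²`. -/
def pointIdeal (p : Fin 2 → ℂ) : Ideal (MvPolynomial (Fin 2) ℂ) :=
  RingHom.ker (eval p)

instance pointIdeal_isPrime (p : Fin 2 → ℂ) : (pointIdeal p).IsPrime :=
  RingHom.ker_isPrime (eval p)

/-- The local ring of the affine plane at the point `p`. -/
abbrev LocalRingAt (p : Fin 2 → ℂ) : Type := Localization.AtPrime (pointIdeal p)

/-- The intersection multiplicity at `p` of the affine plane curves `f = 0` and `g = 0`: the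
dimension over `ℂ` (possibly `⊤`) of the local ring of the plane at `p` modulo `f` and `g`. -/
def affineIntersectionMultiplicity (f g : MvPolynomial (Fin 2) ℂ) (p : Fin 2 → ℂ) : ℕ∞ :=
  Cardinal.toENat (Module.rank ℂ
    (LocalRingAt p ⧸ (Ideal.span
      {algebraMap (MvPolynomial (Fin 2) ℂ) (LocalRingAt p) f,
       algebraMap (MvPolynomial (Fin 2) ℂ) (LocalRingAt p) g} : Ideal (LocalRingAt p))))

/-- Dehomogenization with respect to the `i`-th variable: substitute `1` for it and keep the
other two, in their order, as affine coordinates. -/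
def dehomogenize (i : Fin 3) : MvPolynomial (Fin 3) ℂ →ₐ[ℂ] MvPolynomial (Fin 2) ℂ :=
  aeval (i.insertNth (1 : MvPolynomial (Fin 2) ℂ) (fun j => X j) :
    Fin 3 → MvPolynomial (Fin 2) ℂ)

/-- The affine coordinates of `P` in the chart where the `i`-th coordinate is `1`
(meaningful if the `i`-th homogeneous coordinate of `P` is nonzero). -/
def affineCoords (i : Fin 3) (P : ProjPlane) : Fin 2 → ℂ :=
  fun j => P.rep (i.succAbove j) / P.rep i

theorem exists_rep_ne_zero (P : ProjPlane) : ∃ i, P.rep i ≠ 0 :=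
  Function.ne_iff.mp P.rep_nonzero

/-- The index of a standard affine chart that contains `P`. -/
def chart (P : ProjPlane) : Fin 3 := (exists_rep_ne_zero P).choose

/-- The intersection multiplicity at `P ∈ ℙ²` of the plane curves with homogeneous equations
`C = 0` and `D = 0`, computed in a standard affine chart containing `P` (it does not depend on
the chart). -/
def intersectionMultiplicity (C D : MvPolynomial (Fin 3) ℂ) (P : ProjPlane) : ℕ∞ :=
  affineIntersectionMultiplicity (dehomogenize (chart P) C) (dehomogenize (chart P) D)
    (affineCoords (chart P) P)

/-- `P` is a flex of the curve `C = 0`: it lies on it, and some line meets the curve at `P`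
with multiplicity at least `3`. -/
def IsFlex (C : MvPolynomial (Fin 3) ℂ) (P : ProjPlane) : Prop :=
  OnCurve C P ∧ ∃ L : MvPolynomial (Fin 3) ℂ, L.IsHomogeneous 1 ∧ L ≠ 0 ∧
    3 ≤ intersectionMultiplicity C L P

/-! ### The Fermat cubic -/

/-- The Fermat cubic `x³ + y³ + z³`. -/
def fermatCubic : MvPolynomial (Fin 3) ℂ := X 0 ^ 3 + X 1 ^ 3 + X 2 ^ 3

/-- Type-9 points of the Fermat cubic `F`: the points of `F`, other than the flexes, at which
some irreducible cubic meets `F` with multiplicity exactly `9`. -/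
def IsTypeNine (P : ProjPlane) : Prop :=
  OnCurve fermatCubic P ∧ ¬ IsFlex fermatCubic P ∧
    ∃ G : MvPolynomial (Fin 3) ℂ, G.IsHomogeneous 3 ∧ Irreducible G ∧
      intersectionMultiplicity fermatCubic G P = 9

/-! ### The group law on the Fermat cubic -/

/-- The points of the Fermat cubic. -/
def FermatPoint : Type := {P : ProjPlane // OnCurve fermatCubic P}

theorem onCurve_fermat_mk (v : Fin 3 → ℂ) (hv : v ≠ 0) :
    OnCurve fermatCubic (Projectivization.mk ℂ v hv) ↔ v 0 ^ 3 + v 1 ^ 3 + v 2 ^ 3 = 0 := by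
  obtain ⟨a, ha⟩ := Projectivization.exists_smul_eq_mk_rep ℂ v hv
  have h0 : (a : ℂ) ^ 3 ≠ 0 := pow_ne_zero _ a.ne_zero
  have key : eval (Projectivization.mk ℂ v hv).rep fermatCubic
      = (a : ℂ) ^ 3 * (v 0 ^ 3 + v 1 ^ 3 + v 2 ^ 3) := by
    rw [← ha]
    simp only [fermatCubic, map_add, map_pow, eval_X, Pi.smul_apply, Units.smul_def, smul_eq_mul]
    ring
  unfold OnCurve
  rw [key, mul_eq_zero]
  simp [h0]

/-- The Weierstrass curve `y² = x³ - 432`. -/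
def fermatWeierstrass : WeierstrassCurve.Affine ℂ :=
  { a₁ := 0, a₂ := 0, a₃ := 0, a₄ := 0, a₆ := -432 }

theorem fermatWeierstrass_equation_iff (x y : ℂ) :
    fermatWeierstrass.Equation x y ↔ y ^ 2 = x ^ 3 - 432 := by
  rw [WeierstrassCurve.Affine.equation_iff]
  simp [fermatWeierstrass, sub_eq_add_neg]

theorem fermatWeierstrass_nonsingular (x y : ℂ) (h : y ^ 2 = x ^ 3 - 432) :
    fermatWeierstrass.Nonsingular x y := by
  rw [WeierstrassCurve.Affine.nonsingular_iff]
  refine ⟨(fermatWeierstrass_equation_iff x y).2 h, ?_⟩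
  by_contra hcon
  simp only [fermatWeierstrass, not_or, not_not] at hcon
  obtain ⟨h1, h2⟩ := hcon
  have hx : x = 0 := by simpa using h1.symm
  have hy : y = 0 := by
    have : 2 * y = 0 := by linear_combination h2
    simpa using this
  subst hx hy
  norm_num at h

/-- The vector `(36 Z + Y, 36 Z - Y, -6 X)`, a linear change of coordinates that carries the
projective Weierstrass curve `Y² Z = X³ - 432 Z³` onto the Fermat cubic. -/
def fermatVec (x y z : ℂ) : Fin 3 → ℂ := ![36 * z + y, 36 * z - y, -6 * x]

theorem fermatVec_one_ne_zero (x y : ℂ) : fermatVec x y 1 ≠ 0 := by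
  intro h
  have h0 := congrFun h 0
  have h1 := congrFun h 1
  simp [fermatVec] at h0 h1
  have : (72 : ℂ) = 0 := by linear_combination h0 + h1
  norm_num at this

theorem fermatVec_infty_ne_zero : fermatVec 0 1 0 ≠ 0 := by
  intro h
  have h0 := congrFun h 0
  simp [fermatVec] at h0

/-- The restriction to the curve `y² = x³ - 432` of the linear change of coordinates
`fermatVec`: the point at infinity `[0 : 1 : 0]` goes to the flex `[1 : -1 : 0]`, and the affine
point `(x, y)` goes to `[36 + y : 36 - y : -6 x]`. -/
def fermatOfWeierstrass : fermatWeierstrass.Point → FermatPoint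
  | .zero => ⟨Projectivization.mk ℂ (fermatVec 0 1 0) fermatVec_infty_ne_zero, by
      rw [onCurve_fermat_mk]; simp [fermatVec]; ring⟩
  | .some x y h => ⟨Projectivization.mk ℂ (fermatVec x y 1) (fermatVec_one_ne_zero x y), by
      have h' := (fermatWeierstrass_equation_iff x y).1 h.1
      rw [onCurve_fermat_mk]; simp [fermatVec]; linear_combination 216 * h'⟩

theorem fermatOfWeierstrass_injective : Function.Injective fermatOfWeierstrass := by
  intro P Q hPQ
  have hPQ' := congrArg Subtype.val hPQ
  rcases P with _ | ⟨x, y, h⟩ <;> rcases Q with _ | ⟨x', y', h'⟩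
  · rfl
  · exfalso
    simp only [fermatOfWeierstrass] at hPQ'
    rw [Projectivization.mk_eq_mk_iff'] at hPQ'
    obtain ⟨a, ha⟩ := hPQ'
    have h0 := congrFun ha 0
    have h1 := congrFun ha 1
    simp [fermatVec] at h0 h1
    have ha0 : a = 0 := by linear_combination (h0 + h1) / 72
    simp [ha0] at h0
  · exfalso
    simp only [fermatOfWeierstrass] at hPQ'
    rw [Projectivization.mk_eq_mk_iff'] at hPQ'
    obtain ⟨a, ha⟩ := hPQ'
    have h0 := congrFun ha 0
    have h1 := congrFun ha 1
    simp [fermatVec] at h0 h1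
    have : (72 : ℂ) = 0 := by linear_combination -h0 - h1
    norm_num at this
  · simp only [fermatOfWeierstrass] at hPQ'
    rw [Projectivization.mk_eq_mk_iff'] at hPQ'
    obtain ⟨a, ha⟩ := hPQ'
    have h0 := congrFun ha 0
    have h1 := congrFun ha 1
    have h2 := congrFun ha 2
    simp [fermatVec] at h0 h1 h2
    have ha1 : a = 1 := by linear_combination (h0 + h1) / 72
    subst ha1
    have hy : y = y' := by linear_combination (h1 - h0) / 2
    have hx : x = x' := by simpa using h2.symm
    subst hx hy
    rfl

theorem fermatOfWeierstrass_surjective : Function.Surjective fermatOfWeierstrass := by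
  rintro ⟨P, hP⟩
  induction P using Projectivization.ind with
  | h v hv =>
    rw [onCurve_fermat_mk] at hP
    by_cases hs : v 0 + v 1 = 0
    · refine ⟨.zero, Subtype.ext ?_⟩
      simp only [fermatOfWeierstrass]
      rw [Projectivization.mk_eq_mk_iff']
      have h1 : v 1 = -v 0 := by linear_combination hs
      have h2 : v 2 = 0 := by
        rw [h1] at hP
        have : v 2 ^ 3 = 0 := by linear_combination hP
        simpa using this
      have h0 : v 0 ≠ 0 := by
        intro h0
        apply hv
        funext i
        fin_cases i <;> simp [h0, h1, h2]
      refine ⟨(v 0)⁻¹, ?_⟩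
      funext i
      fin_cases i <;> simp [fermatVec, h0, h1, h2]
    · have hw : (36 * (v 0 - v 1) / (v 0 + v 1)) ^ 2
          = (-12 * v 2 / (v 0 + v 1)) ^ 3 - 432 := by
        field_simp
        linear_combination 1728 * hP
      refine ⟨.some _ _ (fermatWeierstrass_nonsingular _ _ hw), Subtype.ext ?_⟩
      simp only [fermatOfWeierstrass]
      rw [Projectivization.mk_eq_mk_iff']
      refine ⟨72 / (v 0 + v 1), ?_⟩
      funext i
      fin_cases i <;> simp [fermatVec] <;> field_simp <;> ring

/-- The isomorphism between the curve `y² = x³ - 432` and the Fermat cubic, on points. -/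
def fermatEquiv : fermatWeierstrass.Point ≃ FermatPoint :=
  Equiv.ofBijective fermatOfWeierstrass
    ⟨fermatOfWeierstrass_injective, fermatOfWeierstrass_surjective⟩

/-- The chord-and-tangent group law on the Fermat cubic with the flex `[1 : -1 : 0]` as neutral
element. Since the isomorphism `fermatEquiv` is a linear change of coordinates and carries the
point at infinity to `[1 : -1 : 0]`, this is the group law of the Weierstrass curve carried over
along it. -/
instance fermatAddCommGroup : AddCommGroup FermatPoint :=
  fermatEquiv.symm.addCommGroup

/-- `P` is a point of the Fermat cubic that is killed by `n` in its group law. -/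
def IsTorsionPoint (n : ℕ) (P : ProjPlane) : Prop :=
  ∃ Q : FermatPoint, Q.1 = P ∧ n • Q = 0

/-! ### The explicit list -/

/-- The vectors of homogeneous coordinates of twelve points, in terms of a cube root `α` of `3`
and a primitive ninth root of unity `β`. -/
def typeNineList (α β : ℂ) : Fin 12 → Fin 3 → ℂ :=
  ![![1, β, β ^ 2],
    ![1, β ^ 2, β ^ 4],
    ![1, β, β ^ 5],
    ![3, α * β * (β ^ 4 + 2 * β ^ 3 - β + 1), -α ^ 2 * (β ^ 2 + β + 1) * (β ^ 3 - β + 1)],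
    ![3, -α * β * (2 * β ^ 4 + β ^ 3 + β + 2), α ^ 2 * (β + 1) * (β - 1) ^ 2],
    ![3, α * β * (β ^ 4 - β ^ 3 - β - 2), -α ^ 2 * β ^ 2 * (β ^ 2 + β + 1)],
    ![3, α * β * (β - 1) * (β ^ 3 + 2), -α ^ 2 * β * (β ^ 2 + β + 1) * (β ^ 2 - β + 1)],
    ![3, α ^ 2 * (β - 1) * (β + 1) * (β ^ 3 + β + 1), α * β * (β ^ 4 - β ^ 3 - β - 2)],
    ![3, α * β * (β - 1) ^ 2 * (β ^ 2 + β + 1), -α ^ 2 * β * (β ^ 2 + β + 1) * (β ^ 2 - β + 1)],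
    ![3, α * β * (β - 1) ^ 2 * (β ^ 2 + β + 1), α ^ 2 * (β - 1) * (β ^ 3 + β ^ 2 + 1)],
    ![3, α * β * (β ^ 4 + 2 * β ^ 3 + 2 * β + 1), -α ^ 2 * β ^ 2 * (β ^ 2 + β + 1)],
    ![3, -α ^ 2 * (β ^ 2 + β + 1) * (β ^ 3 - β + 1), -α * β * (2 * β ^ 4 + β ^ 3 + β + 2)]]

end

/-! Points of F on the coordinate triangle are flexes, so let P be a point of F off it. Near P the
cubic has a formal parametrization, and the intersection multiplicity with a curve G is the order of
G along it (`affineIntersectionMultiplicity_eq_order`, `exists_parametrization`). The question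
becomes which orders the nine-dimensional space of cubics modulo F attains at P.

Let Q = -2P be the third intersection of the tangent at P, and R = 4P that of the tangent at Q. In
coordinates N, L, T for the frame P, Q, R, the equation of F reads N L² = a N²T + k L T² + d N T² +
e N L T, and N, L, T have orders 0, 1, 2 at P (`exists_frame`). Multiplied by N², every cubic
reduces by this relation to a combination of nine series. If d ≠ 0 their orders are 0, …, 8, and a
cubic of order at least 9 vanishes on F. If d = 0 the last order jumps from 8 to 9 and an explicit
cubic of order 9 appears; lines then have order at most 2 and conics at most 5, so that cubic cannot
factor (`isTypeNine_iff`). If Q is a flex, the frame degenerates; a coordinate vertex replaces R,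
and order 9 is again excluded.

The condition d = 0 says that P lies on the tangent at R, that is -8P = P, or 9P = 0; the points
with 3P = 0 are those on the triangle (`isTorsionPoint_nine_and_not_three_iff`).

In the cubes a = x³, b = y³ the condition is a binary form of degree 8 with eight distinct roots
b/a, and each root leaves 3 · 3 choices of cube roots, whence 72 points. Up to permuting coordinates
the roots fall into two classes, represented by T₁ and T₄; the other listed points arise from these
two by cube roots of unity (`IsNine.isListed`, `isNine_typeNineList`). The field of definition is
read off from the list. -/

noncomputable section
open MvPolynomial

/-! ### Intersection multiplicity as order of vanishing along a formal branch -/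

/-- A complex power series whose constant coefficient is a nonzero cube is a cube. -/
theorem PowerSeries.exists_cube_root (r : PowerSeries ℂ) (c : ℂ) (hc : c ≠ 0)
    (h : PowerSeries.constantCoeff r = c ^ 3) :
    ∃ q : PowerSeries ℂ, q ^ 3 = r ∧ PowerSeries.constantCoeff q = c := by
  -- The series (1 + X)^(1/3). Substituting u = r / c³ - 1, which has no constant term, and scaling
  -- by c gives the root.
  have hbin : (PowerSeries.binomialSeries ℂ (1 / 3 : ℚ)) ^ 3 = 1 + PowerSeries.X := by
    rw [pow_succ, pow_two, ← PowerSeries.binomialSeries_add, ← PowerSeries.binomialSeries_add,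
      show (1 / 3 : ℚ) + 1 / 3 + 1 / 3 = ((1 : ℕ) : ℚ) by norm_num,
      PowerSeries.binomialSeries_nat, pow_one]
  set u : PowerSeries ℂ := PowerSeries.C ((c ^ 3)⁻¹) * r - 1 with hu
  have hu0 : PowerSeries.constantCoeff u = 0 := by simp [hu, h, hc]
  have hs : PowerSeries.HasSubst u := PowerSeries.HasSubst.of_constantCoeff_zero' hu0
  refine ⟨PowerSeries.C c * PowerSeries.substAlgHom hs (PowerSeries.binomialSeries ℂ (1 / 3 : ℚ)),
    ?_, ?_⟩
  · rw [mul_pow, ← map_pow, ← map_pow, hbin, map_add, map_one, PowerSeries.substAlgHom_X, hu]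
    rw [add_sub_cancel, ← mul_assoc, ← map_mul, mul_inv_cancel₀ (pow_ne_zero 3 hc), map_one,
      one_mul]
  · have h0 : PowerSeries.constantCoeff
        (PowerSeries.subst u (PowerSeries.binomialSeries ℂ (1 / 3 : ℚ) - 1)) = 0 :=
      PowerSeries.constantCoeff_subst_eq_zero hu0 _ (by simp)
    rw [← PowerSeries.coe_substAlgHom hs, map_sub, map_one, map_sub, map_one, sub_eq_zero] at h0
    rw [map_mul, PowerSeries.constantCoeff_C, h0, mul_one]

/-- A polynomial vanishing at `p` lies in the ideal generated by the `X j - p j`. -/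
theorem mem_span_of_eval_eq_zero (p : Fin 2 → ℂ) (a : MvPolynomial (Fin 2) ℂ) (ha : eval p a = 0) :
    a ∈ Ideal.span (Set.range fun j => (X j - C (p j) : MvPolynomial (Fin 2) ℂ)) := by
  set J := Ideal.span (Set.range fun j => (X j - C (p j) : MvPolynomial (Fin 2) ℂ))
  have key : Ideal.Quotient.mkₐ ℂ J =
      (Algebra.ofId ℂ (MvPolynomial (Fin 2) ℂ ⧸ J)).comp (aeval p) := by
    refine MvPolynomial.algHom_ext fun j => ?_
    have h1 : Ideal.Quotient.mk J (X j - C (p j)) = 0 :=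
      Ideal.Quotient.eq_zero_iff_mem.2 (Ideal.subset_span ⟨j, rfl⟩)
    rw [map_sub, sub_eq_zero] at h1
    rw [AlgHom.comp_apply, aeval_X]
    exact h1
  have := DFunLike.congr_fun key a
  rw [AlgHom.comp_apply, aeval_eq_eval] at this
  erw [ha, map_zero] at this
  exact Ideal.Quotient.eq_zero_iff_mem.1 this

/-- The intersection multiplicity of `f` and `g` at a smooth point of `f = 0` is the order of
vanishing of `g` along a formal parametrization of the branch of `f`. -/
theorem affineIntersectionMultiplicity_eq_order (f g : MvPolynomial (Fin 2) ℂ) (p : Fin 2 → ℂ)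
    (ψ : MvPolynomial (Fin 2) ℂ →ₐ[ℂ] PowerSeries ℂ) (τ : MvPolynomial (Fin 2) ℂ)
    (hψ : ∀ a, PowerSeries.constantCoeff (ψ a) = eval p a) (hτ : ψ τ = PowerSeries.X)
    (hf : ψ f = 0)
    (hm : ∀ j, ∃ w, eval p w ≠ 0 ∧ w * (X j - C (p j)) ∈ Ideal.span {τ, f}) :
    affineIntersectionMultiplicity f g p = (ψ g).order := by
  let ι := algebraMap (MvPolynomial (Fin 2) ℂ) (LocalRingAt p)
  have hunit : ∀ a, eval p a ≠ 0 → IsUnit (ι a) := fun a ha =>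
    IsLocalization.map_units (LocalRingAt p) (⟨a, ha⟩ : (pointIdeal p).primeCompl)
  obtain ⟨Ψ, hΨ⟩ : ∃ Ψ : LocalRingAt p →ₐ[ℂ] PowerSeries ℂ, ∀ a, Ψ (ι a) = ψ a := by
    have hu : ∀ y : (pointIdeal p).primeCompl, IsUnit (ψ y) := fun y => by
      rw [PowerSeries.isUnit_iff_constantCoeff, hψ]
      exact isUnit_iff_ne_zero.2 y.2
    exact ⟨IsLocalization.liftAlgHom (S := LocalRingAt p) hu,
      fun a => IsLocalization.liftAlgHom_apply .. |>.trans (IsLocalization.lift_eq _ a)⟩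
  have hfrac : ∀ h : LocalRingAt p, ∃ a s, eval p s ≠ 0 ∧ h * ι s = ι a := fun h => by
    obtain ⟨a, s, rfl⟩ := IsLocalization.exists_mk'_eq (pointIdeal p).primeCompl h
    exact ⟨a, s, s.2, IsLocalization.mk'_spec _ _ _⟩
  -- The multipliers `w` of `hm` become units in the local ring, so `τ` and `f` generate its maximal
  -- ideal.
  have hmax : ∀ a, eval p a = 0 → ι a ∈ Ideal.span {ι τ, ι f} := fun a ha => by
    have h1 := Ideal.mem_map_of_mem ι (mem_span_of_eval_eq_zero p a ha)
    refine (Ideal.map_le_iff_le_comap.2 (Ideal.span_le.2 ?_)) h1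
    rintro _ ⟨j, rfl⟩
    obtain ⟨w, hw, hwj⟩ := hm j
    have h2 := Ideal.mem_map_of_mem ι hwj
    rw [Ideal.map_span, Set.image_pair, map_mul] at h2
    exact (Ideal.unit_mul_mem_iff_mem _ (hunit w hw)).1 h2
  have hdec : ∀ h : LocalRingAt p, ∃ (c : ℂ) (x y : LocalRingAt p),
      h = algebraMap ℂ _ c + x * ι τ + y * ι f := fun h => by
    obtain ⟨a, s, hs, has⟩ := hfrac h
    have h1 : ι (a - C (eval p a / eval p s) * s) ∈ Ideal.span {ι τ, ι f} :=
      hmax _ (by simp [hs])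
    have h2 : ι (C (eval p a / eval p s)) = algebraMap ℂ _ (eval p a / eval p s) :=
      (IsScalarTower.algebraMap_apply ℂ (MvPolynomial (Fin 2) ℂ) (LocalRingAt p) _).symm
    rw [map_sub, map_mul, ← has, ← sub_mul, Ideal.mul_unit_mem_iff_mem _ (hunit s hs), h2,
      Ideal.mem_span_pair] at h1
    obtain ⟨x, y, hxy⟩ := h1
    exact ⟨_, x, y, by rw [add_assoc, hxy]; ring⟩
  -- Taylor expansion in `τ` to order `n`, modulo `f`: the coefficient of the remainder is split
  -- again by `hdec`.
  have hexp : ∀ (n : ℕ) (h : LocalRingAt p), ∃ (c : ℕ → ℂ) (x y : LocalRingAt p),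
      h = ∑ i ∈ Finset.range n, c i • ι τ ^ i + x * ι τ ^ n + y * ι f := fun n h => by
    induction n with
    | zero => exact ⟨0, h, 0, by simp⟩
    | succ n ih =>
      obtain ⟨c, x, y, hx⟩ := ih
      obtain ⟨c', x', y', hx'⟩ := hdec x
      refine ⟨Function.update c n c', x', y + y' * ι τ ^ n, ?_⟩
      rw [Finset.sum_range_succ, Finset.sum_congr rfl (g := fun i => c i • ι τ ^ i),
        Function.update_self, Algebra.smul_def]
      · linear_combination hx + ι τ ^ n * hx'
      · intro i hi
        rw [Function.update_of_ne (Finset.mem_range.1 hi).ne]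
  set I : Ideal (LocalRingAt p) := Ideal.span {ι f, ι g} with hI
  have hΨτ : Ψ (ι τ) = PowerSeries.X := (hΨ τ).trans hτ
  have hΨf : Ψ (ι f) = 0 := (hΨ f).trans hf
  -- Polynomials in `τ` of degree less than `n`. For `n` up to the order of `ψ g` they inject into
  -- the quotient, and at `n` equal to that order they fill it; if `ψ g = 0` they make the dimension
  -- infinite.
  let θ : ∀ n : ℕ, (Fin n → ℂ) →ₗ[ℂ] LocalRingAt p ⧸ I := fun n =>
    (Ideal.Quotient.mkₐ ℂ I).toLinearMap ∘ₗ Fintype.linearCombination ℂ fun i : Fin n => ι τ ^ (i : ℕ)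
  have hθ : ∀ n c, θ n c = Ideal.Quotient.mk I (∑ i : Fin n, c i • ι τ ^ (i : ℕ)) := fun n c => by
    simp [θ, Fintype.linearCombination_apply]
  have hinj : ∀ n : ℕ, (n : ℕ∞) ≤ (ψ g).order → Function.Injective (θ n) := fun n hn => by
    rw [injective_iff_map_eq_zero]
    intro c hc
    rw [hθ, Ideal.Quotient.eq_zero_iff_mem, hI, Ideal.mem_span_pair] at hc
    obtain ⟨x, y, hxy⟩ := hc
    have h1 := congrArg Ψ hxy
    rw [map_add, map_mul, map_mul, hΨf, hΨ, mul_zero, zero_add, map_sum] at h1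
    simp only [map_smul, map_pow, hΨτ] at h1
    funext i
    have h2 := congrArg (PowerSeries.coeff (i : ℕ)) h1
    rw [PowerSeries.coeff_of_lt_order, map_sum] at h2
    · simp only [map_smul, PowerSeries.coeff_X_pow, smul_eq_mul, mul_ite, mul_one, mul_zero,
        Fin.val_inj, Finset.sum_ite_eq, Finset.mem_univ, if_true] at h2
      exact h2.symm
    · rw [PowerSeries.order_mul]
      exact lt_of_lt_of_le (by exact_mod_cast i.2) (hn.trans le_add_self)
  have hrank : ∀ n : ℕ, (n : ℕ∞) ≤ (ψ g).order →
      (n : Cardinal) ≤ Module.rank ℂ (LocalRingAt p ⧸ I) := fun n hn => by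
    simpa using LinearMap.rank_le_of_injective (θ n) (hinj n hn)
  change Cardinal.toENat (Module.rank ℂ (LocalRingAt p ⧸ I)) = _
  by_cases hg : ψ g = 0
  · rw [hg, PowerSeries.order_zero, Cardinal.toENat_eq_top]
    exact Cardinal.aleph0_le.2 fun n => hrank n (by rw [hg, PowerSeries.order_zero]; exact le_top)
  obtain ⟨n, hn⟩ := ENat.ne_top_iff_exists.1 (fun h => hg (PowerSeries.order_eq_top.1 h))
  rw [← hn]
  suffices hsurj : Function.Surjective (θ n) by
    have := (LinearEquiv.ofBijective (θ n) ⟨hinj n hn.le, hsurj⟩).rank_eq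
    rw [← this]
    simp
  -- Applying `Ψ` to the expansion of `g` kills the terms below degree `n`. What remains is g = x τⁿ
  -- + y f, with `x` a unit because the `n`-th coefficient of `ψ g` is nonzero.
  have hτn : ι τ ^ n ∈ I := by
    obtain ⟨c, x, y, hx⟩ := hexp n (ι g)
    have h1 := congrArg Ψ hx
    rw [hΨ, map_add, map_add, map_mul, map_mul, hΨf, mul_zero, add_zero, map_sum] at h1
    simp only [map_smul, map_pow, hΨτ] at h1
    have hc : ∀ i < n, c i = 0 := fun i hi => by
      have h2 := congrArg (PowerSeries.coeff i) h1
      rw [PowerSeries.coeff_of_lt_order _ (by rw [← hn]; exact_mod_cast hi), map_add, map_sum,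
        PowerSeries.coeff_mul_X_pow', if_neg (not_le.2 hi), add_zero] at h2
      simp only [map_smul, PowerSeries.coeff_X_pow, smul_eq_mul, mul_ite, mul_one, mul_zero,
        Finset.sum_ite_eq, Finset.mem_range, hi, if_true] at h2
      exact h2.symm
    have hs0 : ∀ {A : Type} [CommRing A] [Algebra ℂ A] (z : A),
        ∑ i ∈ Finset.range n, c i • z ^ i = 0 := fun z =>
      Finset.sum_eq_zero fun i hi => by rw [hc i (Finset.mem_range.1 hi), zero_smul]
    rw [hs0, zero_add] at h1 hx
    have hx0 : PowerSeries.constantCoeff (Ψ x) ≠ 0 := fun h0 => by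
      have h2 : PowerSeries.coeff n (ψ g) = 0 := by
        rw [h1, PowerSeries.coeff_mul_X_pow', if_pos le_rfl, Nat.sub_self,
          PowerSeries.coeff_zero_eq_constantCoeff_apply, h0]
      have h3 := PowerSeries.coeff_order hg
      rw [← hn, ENat.toNat_natCast] at h3
      exact h3 h2
    have hxu : IsUnit x := by
      obtain ⟨a, s, hs, has⟩ := hfrac x
      have ha : eval p a ≠ 0 := by
        rw [← hψ, ← hΨ, ← has, map_mul, map_mul, hΨ, hψ]
        exact mul_ne_zero hx0 hs
      have := hunit a ha
      rw [← has] at this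
      exact isUnit_of_mul_isUnit_left this
    rw [← Ideal.unit_mul_mem_iff_mem I hxu, show x * ι τ ^ n = ι g - y * ι f by rw [hx]; ring]
    exact I.sub_mem (Ideal.subset_span (by simp)) (I.mul_mem_left _ (Ideal.subset_span (by simp)))
  intro h
  obtain ⟨h, rfl⟩ := Ideal.Quotient.mk_surjective h
  obtain ⟨c, x, y, hx⟩ := hexp n h
  refine ⟨fun i => c i, ?_⟩
  rw [hθ, Ideal.Quotient.eq, hx, Fin.sum_univ_eq_sum_range (fun i => c i • ι τ ^ i)]
  rw [show ∀ s a b : LocalRingAt p, s - (s + a + b) = -(a + b) by intros; ring]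
  exact I.neg_mem (I.add_mem (I.mul_mem_left _ hτn)
    (I.mul_mem_left _ (Ideal.subset_span (by simp))))

end

/-! ### Formal branches of the Fermat cubic -/

noncomputable section
open MvPolynomial

/-- Since `p k ≠ 0`, the derivative 3 X_k² does not vanish at `p`; hence X_j - p_j is a local
parameter, and X_k is the cube root of -1 - X_j³ that starts with `p k`. -/
theorem affine_fermat_multiplicity {j k : Fin 2} (hjk : j ≠ k) (p : Fin 2 → ℂ)
    (hp : p j ^ 3 + p k ^ 3 + 1 = 0) (hk : p k ≠ 0) :
    ∃ z : Fin 2 → PowerSeries ℂ, z j ^ 3 + z k ^ 3 + 1 = 0 ∧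
      (∀ l, PowerSeries.constantCoeff (z l) = p l) ∧
      z j = PowerSeries.C (p j) + PowerSeries.X ∧
      ∀ g, affineIntersectionMultiplicity (X j ^ 3 + X k ^ 3 + 1) g p = (aeval z g).order := by
  obtain ⟨q, hq, hq0⟩ := PowerSeries.exists_cube_root
    (-1 - (PowerSeries.C (p j) + PowerSeries.X) ^ 3) (p k) hk (by
      simp only [map_sub, map_neg, map_one, map_pow, map_add, PowerSeries.constantCoeff_C,
        PowerSeries.constantCoeff_X]
      linear_combination -hp)
  have hcases : ∀ l : Fin 2, l = j ∨ l = k := by omega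
  let z : Fin 2 → PowerSeries ℂ := fun l => if l = j then PowerSeries.C (p j) + PowerSeries.X else q
  have hzj : z j = PowerSeries.C (p j) + PowerSeries.X := if_pos rfl
  have hzk : z k = q := if_neg hjk.symm
  have hz0 : ∀ l, PowerSeries.constantCoeff (z l) = p l := fun l => by
    rcases hcases l with rfl | rfl
    · rw [hzj]; simp
    · rw [hzk, hq0]
  have hz : z j ^ 3 + z k ^ 3 + 1 = 0 := by rw [hzj, hzk, hq]; ring
  refine ⟨z, hz, hz0, hzj, fun g => ?_⟩
  refine affineIntersectionMultiplicity_eq_order _ g p (aeval z) (X j - C (p j)) ?_ ?_ ?_ ?_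
  · intro a
    induction a using MvPolynomial.induction_on with
    | C c => rw [algHom_C, eval_C]; exact PowerSeries.constantCoeff_C c
    | add a b ha hb => rw [map_add, map_add, map_add, ha, hb]
    | mul_X a l ha => rw [map_mul, map_mul, map_mul, ha, aeval_X, eval_X, hz0]
  · rw [map_sub, aeval_X, algHom_C, hzj]
    exact add_sub_cancel_left _ _
  · simpa using hz
  · intro l
    rcases hcases l with rfl | rfl
    · exact ⟨1, by simp, by rw [one_mul]; exact Ideal.subset_span (by simp)⟩
    -- The cofactor in X³ - p³ = (X - p)(X² + pX + p²), with value 3p² at the point.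
    · refine ⟨X l ^ 2 + X l * C (p l) + C (p l) ^ 2, ?_, ?_⟩
      · simp only [map_add, map_mul, map_pow, eval_X, eval_C]
        rw [show p l ^ 2 + p l * p l + p l ^ 2 = 3 * p l ^ 2 by ring]
        exact mul_ne_zero (by norm_num) (pow_ne_zero 2 hk)
      · refine Ideal.mem_span_pair.2 ⟨-(X j ^ 2 + X j * C (p j) + C (p j) ^ 2), 1, ?_⟩
        have h : C (p j) ^ 3 + C (p l) ^ 3 + 1 = (0 : MvPolynomial (Fin 2) ℂ) := by
          rw [← map_pow, ← map_pow, ← map_one C, ← map_add, ← map_add, hp, map_zero]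
        linear_combination h

theorem dehomogenize_fermatCubic (i : Fin 3) :
    dehomogenize i fermatCubic = X 0 ^ 3 + X 1 ^ 3 + 1 := by
  have h : ∀ (a b c : MvPolynomial (Fin 2) ℂ) (v : Fin 3 → MvPolynomial (Fin 2) ℂ), v = ![a, b, c] →
      aeval v fermatCubic = a ^ 3 + b ^ 3 + c ^ 3 := by
    rintro a b c _ rfl
    simp [fermatCubic]
  fin_cases i
  · refine (h 1 (X 0) (X 1) _ ?_).trans (by ring)
    funext l; fin_cases l <;> rfl
  · refine (h (X 0) 1 (X 1) _ ?_).trans (by ring)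
    funext l; fin_cases l <;> rfl
  · refine (h (X 0) (X 1) 1 _ ?_).trans (by ring)
    funext l; fin_cases l <;> rfl

/-- Near each of its points the Fermat cubic has a formal parametrization, and intersection
multiplicities are orders of vanishing along it. -/
theorem exists_parametrization (P : ProjPlane) (hP : OnCurve fermatCubic P) :
    ∃ w : Fin 3 → PowerSeries ℂ,
      (∀ G, intersectionMultiplicity fermatCubic G P = (aeval w G).order) ∧
      w 0 ^ 3 + w 1 ^ 3 + w 2 ^ 3 = 0 ∧ (∃ i, w i = 1) ∧
      (∃ k : ℂ, k ≠ 0 ∧ ∀ j, PowerSeries.constantCoeff (w j) = k * P.rep j) ∧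
      PowerSeries.X ∈ Submodule.span ℂ (Set.range w) := by
  set i := chart P with hi
  have hri : P.rep i ≠ 0 := (exists_rep_ne_zero P).choose_spec
  set p := affineCoords i P with hp
  have hdeh : ∀ {A : Type} [CommRing A] [Algebra ℂ A] (z : Fin 2 → A) (G : MvPolynomial (Fin 3) ℂ),
      aeval z (dehomogenize i G) = aeval (i.insertNth (1 : A) z : Fin 3 → A) G := fun z G => by
    rw [dehomogenize, ← AlgHom.comp_apply]
    congr 1
    refine MvPolynomial.algHom_ext fun j => ?_
    rw [AlgHom.comp_apply, aeval_X, aeval_X]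
    refine Fin.succAboveCases i ?_ (fun l => ?_) j
    · simp
    · simp
  have hins : ∀ j, (i.insertNth (1 : ℂ) p : Fin 3 → ℂ) j = (P.rep i)⁻¹ * P.rep j := fun j => by
    refine Fin.succAboveCases i ?_ (fun l => ?_) j
    · simp [hri]
    · simp [hp, affineCoords, div_eq_inv_mul]
  have hsum : p 0 ^ 3 + p 1 ^ 3 + 1 = 0 := by
    have h1 := hdeh p fermatCubic
    rw [dehomogenize_fermatCubic] at h1
    have h2 : eval P.rep fermatCubic = 0 := hP
    simp only [fermatCubic, map_add, map_pow, map_one, aeval_X, eval_X, hins] at h1 h2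
    linear_combination h1 + (P.rep i)⁻¹ ^ 3 * h2
  -- The affine coordinates cannot both vanish, as their cubes sum to -1; a nonzero one is taken as
  -- dependent variable.
  obtain ⟨j, k, hjk, hk, hsum'⟩ : ∃ j k, j ≠ k ∧ p k ≠ 0 ∧
      (X j ^ 3 + X k ^ 3 + 1 : MvPolynomial (Fin 2) ℂ) = X 0 ^ 3 + X 1 ^ 3 + 1 := by
    by_cases h1 : p 1 = 0
    · refine ⟨1, 0, by decide, fun h0 => ?_, by ring⟩
      simp [h0, h1] at hsum
    · exact ⟨0, 1, by decide, h1, rfl⟩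
  obtain ⟨z, hz, hz0, hzj, hmult⟩ := affine_fermat_multiplicity hjk p (by
    simpa [← hsum'] using congrArg (eval p) hsum' |>.trans (by simpa using hsum)) hk
  have hwfer := hdeh z fermatCubic
  rw [dehomogenize_fermatCubic, ← hsum'] at hwfer
  simp only [fermatCubic, map_add, map_pow, map_one, aeval_X, hz] at hwfer
  refine ⟨i.insertNth 1 z, fun G => ?_, hwfer.symm, ⟨i, by simp⟩,
    ⟨(P.rep i)⁻¹, inv_ne_zero hri, fun j => ?_⟩, ?_⟩
  · rw [← hdeh, ← hmult, hsum', ← dehomogenize_fermatCubic i]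
    rfl
  · rw [← hins]
    refine Fin.succAboveCases i ?_ (fun l => ?_) j
    · simp
    · simp [hz0]
  · have h1 : (1 : PowerSeries ℂ) ∈ Submodule.span ℂ
        (Set.range (i.insertNth 1 z : Fin 3 → PowerSeries ℂ)) :=
      Submodule.subset_span ⟨i, by simp⟩
    have h2 : z j ∈ Submodule.span ℂ (Set.range (i.insertNth 1 z : Fin 3 → PowerSeries ℂ)) :=
      Submodule.subset_span ⟨i.succAbove j, by simp⟩
    have h3 : PowerSeries.X = z j - p j • (1 : PowerSeries ℂ) := by
      rw [hzj, PowerSeries.smul_eq_C_mul]; ring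
    rw [h3]
    exact Submodule.sub_mem _ h2 (Submodule.smul_mem _ _ h1)
end

/-! ### Flexes, and orders of forms of bounded degree -/

noncomputable section
open MvPolynomial

/-- The tangent line at a point of the Fermat cubic with a vanishing coordinate meets the curve
there to order at least three. -/
theorem three_le_order_tangent {x y z : PowerSeries ℂ} {b c k : ℂ}
    (h : x ^ 3 + y ^ 3 + z ^ 3 = 0) (hx : PowerSeries.constantCoeff x = 0)
    (hy : PowerSeries.constantCoeff y = k * b) (hz : PowerSeries.constantCoeff z = k * c)
    (hk : k ≠ 0) (hb : b ≠ 0) (hbc : b ^ 3 + c ^ 3 = 0) :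
    3 ≤ (PowerSeries.C (b ^ 2) * y + PowerSeries.C (c ^ 2) * z).order := by
  set Y := PowerSeries.C (b ^ 2) * y with hY
  set Z := PowerSeries.C (c ^ 2) * z with hZ
  have hbc' : PowerSeries.C b ^ 3 + PowerSeries.C c ^ 3 = (0 : PowerSeries ℂ) := by
    rw [← map_pow, ← map_pow, ← map_add, hbc, map_zero]
  -- The left side is Y³ + Z³, and b⁶ = c⁶ turns it into b⁶(y³ + z³). The quadratic factor is a
  -- unit, so Y + Z inherits the order of x³.
  have h1 : (Y + Z) * (Y ^ 2 - Y * Z + Z ^ 2) = PowerSeries.C (-b ^ 6) * x ^ 3 := by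
    simp only [hY, hZ, map_pow, map_neg]
    linear_combination PowerSeries.C b ^ 6 * h +
      z ^ 3 * (PowerSeries.C c ^ 3 - PowerSeries.C b ^ 3) * hbc'
  have h2 : (Y ^ 2 - Y * Z + Z ^ 2).order = 0 := by
    refine PowerSeries.order_zero_of_unit (PowerSeries.isUnit_iff_constantCoeff.2 ?_)
    have : PowerSeries.constantCoeff (Y ^ 2 - Y * Z + Z ^ 2) = 3 * k ^ 2 * b ^ 6 := by
      simp only [hY, hZ, map_add, map_sub, map_mul, map_pow, PowerSeries.constantCoeff_C, hy, hz]
      linear_combination k ^ 2 * (c ^ 3 - 2 * b ^ 3) * hbc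
    rw [this]
    exact isUnit_iff_ne_zero.2
      (mul_ne_zero (mul_ne_zero three_ne_zero (pow_ne_zero 2 hk)) (pow_ne_zero 6 hb))
  have h3 := congrArg PowerSeries.order h1
  rw [PowerSeries.order_mul, h2, add_zero, PowerSeries.order_mul] at h3
  rw [h3]
  exact (PowerSeries.le_order_pow_of_constantCoeff_eq_zero 3 hx).trans le_add_self

/-- The witness is the tangent line, whose coefficients are the squares of the coordinates (the
gradient up to the factor 3). -/
theorem isFlex_of_coord_eq_zero (P : ProjPlane) (hP : OnCurve fermatCubic P) (j : Fin 3)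
    (hj : P.rep j = 0) : IsFlex fermatCubic P := by
  obtain ⟨w, hmult, hw, -, ⟨k, hk, hk'⟩, -⟩ := exists_parametrization P hP
  have hP' : P.rep 0 ^ 3 + P.rep 1 ^ 3 + P.rep 2 ^ 3 = 0 := by
    simpa [OnCurve, fermatCubic] using hP
  have hne := P.rep_nonzero
  refine ⟨hP, ∑ l, C (P.rep l ^ 2) * X l, ?_, ?_, ?_⟩
  · exact IsHomogeneous.sum _ _ _ fun l _ => isHomogeneous_C_mul_X _ l
  · intro h
    obtain ⟨l, hl⟩ := exists_rep_ne_zero P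
    have := congrArg (eval (Pi.single l 1)) h
    simp [Pi.single_apply, hl] at this
  · have hC : ∀ c : ℂ, algebraMap ℂ (PowerSeries ℂ) c = PowerSeries.C c := fun _ => rfl
    rw [hmult]
    simp only [Fin.sum_univ_three, map_add, map_mul, aeval_X, algHom_C, hC]
    have hb : ∀ b c : ℂ, b ^ 3 + c ^ 3 = 0 → b = 0 → c = 0 := by
      rintro b c h rfl
      simpa using h
    have hz : ¬ (P.rep 0 = 0 ∧ P.rep 1 = 0 ∧ P.rep 2 = 0) := fun h => hne (by
      funext l; fin_cases l
      exacts [h.1, h.2.1, h.2.2])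
    fin_cases j
    · simp only [Fin.zero_eta] at hj
      rw [hj] at hP' ⊢
      have h1 : P.rep 1 ^ 3 + P.rep 2 ^ 3 = 0 := by linear_combination hP'
      simpa using three_le_order_tangent hw (by rw [hk', hj, mul_zero]) (hk' 1) (hk' 2) hk
        (fun h => hz ⟨hj, h, hb _ _ h1 h⟩) h1
    · simp only [Fin.mk_one] at hj
      rw [hj] at hP' ⊢
      have h1 : P.rep 0 ^ 3 + P.rep 2 ^ 3 = 0 := by linear_combination hP'
      simpa using three_le_order_tangent (x := w 1) (y := w 0) (z := w 2)
        (by linear_combination hw) (by rw [hk', hj, mul_zero])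
        (hk' 0) (hk' 2) hk (fun h => hz ⟨h, hj, hb _ _ h1 h⟩) h1
    · simp only [Fin.reduceFinMk] at hj
      rw [hj] at hP' ⊢
      have h1 : P.rep 0 ^ 3 + P.rep 1 ^ 3 = 0 := by linear_combination hP'
      simpa using three_le_order_tangent (x := w 2) (y := w 0) (z := w 1)
        (by linear_combination hw) (by rw [hk', hj, mul_zero])
        (hk' 0) (hk' 1) hk (fun h => hz ⟨h, hb _ _ h1 h, hj⟩) h1

/-- The value of a polynomial of total degree at most `n` lies in the `n`-th power of any
submodule that contains `1` and the values of the variables. -/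
theorem aeval_mem_pow {A : Type*} [CommRing A] [Algebra ℂ A] (V : Submodule ℂ A) (h1 : 1 ∈ V)
    (w : Fin 3 → A) (hw : ∀ i, w i ∈ V) (G : MvPolynomial (Fin 3) ℂ) (n : ℕ)
    (hG : G.totalDegree ≤ n) : aeval w G ∈ V ^ n := by
  rw [aeval_def, eval₂_eq']
  refine Submodule.sum_mem _ fun d hd => ?_
  rw [← Algebra.smul_def]
  refine Submodule.smul_mem _ _ ?_
  have hdn : d 0 + d 1 + d 2 ≤ n := by
    have := (le_totalDegree hd).trans hG
    rwa [Finsupp.sum_fintype _ _ (fun _ => rfl), Fin.sum_univ_three] at this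
  refine pow_le_pow_right' (Submodule.one_le.2 h1) hdn ?_
  rw [Fin.prod_univ_three, pow_add, pow_add]
  exact Submodule.mul_mem_mul (Submodule.mul_mem_mul (Submodule.pow_mem_pow _ (hw 0) _)
    (Submodule.pow_mem_pow _ (hw 1) _)) (Submodule.pow_mem_pow _ (hw 2) _)

/-- A linear combination of power series of orders `0, …, n - 1` with order at least `n` has zero
coefficients. -/
theorem coeffs_eq_zero_of_le_order {n : ℕ} (e : Fin n → PowerSeries ℂ)
    (he : ∀ k : Fin n, (e k).order = (k : ℕ)) (c : Fin n → ℂ)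
    (h : (n : ℕ∞) ≤ (∑ k, c k • e k).order) : c = 0 := by
  funext k
  induction k using WellFoundedLT.induction with
  | ind k ih =>
    have h1 := PowerSeries.coeff_of_lt_order (k : ℕ)
      (lt_of_lt_of_le (by exact_mod_cast k.2 : ((k : ℕ) : ℕ∞) < n) h)
    rw [map_sum, Finset.sum_eq_single k] at h1
    · have h2 : PowerSeries.coeff (k : ℕ) (e k) ≠ 0 := (PowerSeries.order_eq_nat.1 (he k)).1
      simpa [h2] using h1
    · intro l _ hl
      rcases lt_or_gt_of_ne hl with hlt | hlt
      · rw [ih l hlt]; simp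
      · rw [map_smul, PowerSeries.coeff_of_lt_order, smul_zero]
        rw [he]
        exact_mod_cast hlt
    · simp

theorem eq_zero_of_mem_span_of_le_order {n : ℕ} (e : Fin n → PowerSeries ℂ)
    (he : ∀ k : Fin n, (e k).order = (k : ℕ)) (h : PowerSeries ℂ)
    (hs : h ∈ Submodule.span ℂ (Set.range e)) (hn : (n : ℕ∞) ≤ h.order) : h = 0 := by
  obtain ⟨c, rfl⟩ := (Submodule.mem_span_range_iff_exists_fun ℂ).1 hs
  rw [coeffs_eq_zero_of_le_order e he c hn]
  simp

end

/-! ### Orders attained by lines, conics and cubics in adapted coordinates -/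

noncomputable section
open MvPolynomial

/-- The multiplier `m` will be a power of N: the equation of the curve rewrites N L², not L², so
monomials can be reduced only after such a multiplication. -/
theorem mul_mem_of_mem_span_sq {A : Type*} [CommRing A] [Algebra ℂ A] {N L T m : A}
    {W : Submodule ℂ A} (hNN : m * (N * N) ∈ W) (hNL : m * (N * L) ∈ W) (hNT : m * (N * T) ∈ W)
    (hLL : m * (L * L) ∈ W) (hLT : m * (L * T) ∈ W) (hTT : m * (T * T) ∈ W) {x : A}
    (hx : x ∈ (Submodule.span ℂ {N, L, T}) ^ 2) : m * x ∈ W := by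
  suffices h : (Submodule.span ℂ {N, L, T}) ^ 2 ≤ W.comap (LinearMap.mulLeft ℂ m) from h hx
  rw [pow_two, Submodule.span_mul_span, Submodule.span_le]
  rintro _ ⟨y, hy, z, hz, rfl⟩
  change m * (y * z) ∈ W
  have hW : ∀ {a b : A}, a = b → b ∈ W → a ∈ W := fun h hb => h ▸ hb
  rcases hy with rfl | rfl | rfl <;> rcases hz with rfl | rfl | rfl <;>
    first
    | exact hW (by ring1) hNN
    | exact hW (by ring1) hNL
    | exact hW (by ring1) hNT
    | exact hW (by ring1) hLL
    | exact hW (by ring1) hLT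
    | exact hW (by ring1) hTT

theorem mul_mem_of_mem_span_cube {A : Type*} [CommRing A] [Algebra ℂ A] {N L T m : A}
    {W : Submodule ℂ A} (h1 : m * N ^ 3 ∈ W) (h2 : m * (N ^ 2 * L) ∈ W) (h3 : m * (N ^ 2 * T) ∈ W)
    (h4 : m * (N * L ^ 2) ∈ W) (h5 : m * (N * L * T) ∈ W) (h6 : m * (N * T ^ 2) ∈ W)
    (h7 : m * L ^ 3 ∈ W) (h8 : m * (L ^ 2 * T) ∈ W) (h9 : m * (L * T ^ 2) ∈ W)
    (h10 : m * T ^ 3 ∈ W) {x : A}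
    (hx : x ∈ (Submodule.span ℂ {N, L, T}) ^ 3) : m * x ∈ W := by
  suffices h : (Submodule.span ℂ {N, L, T}) ^ 3 ≤ W.comap (LinearMap.mulLeft ℂ m) from h hx
  rw [pow_succ, pow_two, Submodule.span_mul_span, Submodule.span_mul_span, Submodule.span_le]
  rintro _ ⟨_, ⟨y, hy, z, hz, rfl⟩, t, ht, rfl⟩
  change m * (y * z * t) ∈ W
  have hW : ∀ {a b : A}, a = b → b ∈ W → a ∈ W := fun h hb => h ▸ hb
  rcases hy with rfl | rfl | rfl <;> rcases hz with rfl | rfl | rfl <;>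
    rcases ht with rfl | rfl | rfl <;>
    first
    | exact hW (by ring1) h1
    | exact hW (by ring1) h2
    | exact hW (by ring1) h3
    | exact hW (by ring1) h4
    | exact hW (by ring1) h5
    | exact hW (by ring1) h6
    | exact hW (by ring1) h7
    | exact hW (by ring1) h8
    | exact hW (by ring1) h9
    | exact hW (by ring1) h10

/-- Multiplication by `m` cannot lower the order, and power series have no zero divisors. -/
theorem eq_zero_of_mul_mem_span {n : ℕ} (v : Fin n → PowerSeries ℂ)
    (hv : ∀ i : Fin n, (v i).order = (i : ℕ)) {m x : PowerSeries ℂ} (hm : m ≠ 0)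
    (hmx : m * x ∈ Submodule.span ℂ (Set.range v)) (hx : (n : ℕ∞) ≤ x.order) : x = 0 := by
  have h := eq_zero_of_mem_span_of_le_order v hv _ hmx (by
    rw [PowerSeries.order_mul]; exact hx.trans le_add_self)
  exact (mul_eq_zero.1 h).resolve_left hm

theorem mem_span_range_of_eq_sum {n : ℕ} {v : Fin n → PowerSeries ℂ} (c : Fin n → ℂ)
    {y : PowerSeries ℂ} (hy : y = ∑ i, PowerSeries.C (c i) * v i) :
    y ∈ Submodule.span ℂ (Set.range v) :=
  (Submodule.mem_span_range_iff_exists_fun ℂ).2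
    ⟨c, by rw [hy]; simp only [PowerSeries.smul_eq_C_mul]⟩

theorem mem_span_range_of_eq {n : ℕ} {v : Fin n → PowerSeries ℂ} (i : Fin n)
    {y : PowerSeries ℂ} (hy : y = v i) : y ∈ Submodule.span ℂ (Set.range v) :=
  Submodule.subset_span ⟨i, hy.symm⟩

theorem eq_zero_of_mem_span_of_three_le_order {N L T : PowerSeries ℂ} (hN : N.order = 0)
    (hL : L.order = 1) (hT : T.order = 2) {x : PowerSeries ℂ}
    (hx : x ∈ Submodule.span ℂ {N, L, T}) (h : 3 ≤ x.order) : x = 0 := by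
  refine eq_zero_of_mem_span_of_le_order ![N, L, T] ?_ x ?_ h
  · intro i
    fin_cases i <;> simp [hN, hL, hT]
  · convert hx using 3
    ext y
    simp only [Matrix.range_cons, Matrix.range_empty, Set.union_empty, Set.singleton_union]

/-- If the tangent at the point `N = T = 0` of a cubic does not degenerate, conics meet the cubic at
the point `L = T = 0` to order at most five. -/
theorem eq_zero_of_mem_span_sq_of_six_le_order {N L T : PowerSeries ℂ} {a k e : ℂ}
    (hN : N.order = 0) (hL : L.order = 1) (hT : T.order = 2)
    (hrel : N * L ^ 2 = PowerSeries.C a * (N ^ 2 * T) + PowerSeries.C k * (L * T ^ 2) +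
      PowerSeries.C e * (N * L * T)) {x : PowerSeries ℂ}
    (hx : x ∈ (Submodule.span ℂ {N, L, T}) ^ 2) (h : 6 ≤ x.order) : x = 0 := by
  let v : Fin 6 → PowerSeries ℂ := ![N ^ 3, N ^ 2 * L, N ^ 2 * T, N * L * T, N * T ^ 2, L * T ^ 2]
  have hv : ∀ i : Fin 6, (v i).order = (i : ℕ) := by
    intro i
    fin_cases i <;> simp [v, PowerSeries.order_mul, PowerSeries.order_pow, hN, hL, hT] <;> rfl
  have hN0 : N ≠ 0 := by rintro rfl; simp at hN
  refine eq_zero_of_mul_mem_span v hv hN0 (mul_mem_of_mem_span_sq ?_ ?_ ?_ ?_ ?_ ?_ hx) h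
  · exact mem_span_range_of_eq 0 (show _ = N ^ 3 by ring)
  · exact mem_span_range_of_eq 1 (show _ = N ^ 2 * L by ring)
  · exact mem_span_range_of_eq 2 (show _ = N ^ 2 * T by ring)
  · exact mem_span_range_of_eq_sum ![0, 0, a, e, 0, k]
      (by simp [Fin.sum_univ_succ, v]; linear_combination hrel)
  · exact mem_span_range_of_eq 3 (show _ = N * L * T by ring)
  · exact mem_span_range_of_eq 4 (show _ = N * T ^ 2 by ring)

/-- The relation reduces N² times each of the ten cubic monomials to the nine series `v`, of orders
0, …, 8. The monomial L³ needs it more than once and produces the last series, k L T⁴ + d N T⁴,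
whose order is 8 rather than 9 precisely because `d ≠ 0`. -/
theorem eq_zero_of_mem_span_cube_of_nine_le_order {N L T : PowerSeries ℂ} {a k d e : ℂ}
    (hN : N.order = 0) (hL : L.order = 1) (hT : T.order = 2)
    (hrel : N * L ^ 2 = PowerSeries.C a * (N ^ 2 * T) + PowerSeries.C k * (L * T ^ 2) +
      PowerSeries.C d * (N * T ^ 2) + PowerSeries.C e * (N * L * T)) (hk : k ≠ 0) (hd : d ≠ 0)
    {x : PowerSeries ℂ} (hx : x ∈ (Submodule.span ℂ {N, L, T}) ^ 3) (h : 9 ≤ x.order) : x = 0 := by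
  let v : Fin 9 → PowerSeries ℂ := ![N ^ 5, N ^ 4 * L, N ^ 4 * T, N ^ 3 * L * T, N ^ 3 * T ^ 2,
    N ^ 2 * L * T ^ 2, N ^ 2 * T ^ 3, N * L * T ^ 3,
    PowerSeries.C k * (L * T ^ 4) + PowerSeries.C d * (N * T ^ 4)]
  have hC : ∀ c : ℂ, c ≠ 0 → (PowerSeries.C c).order = 0 := fun c hc =>
    PowerSeries.order_zero_of_unit ((isUnit_iff_ne_zero.2 hc).map _)
  have hlast : (PowerSeries.C k * (L * T ^ 4) + PowerSeries.C d * (N * T ^ 4)).order = 8 := by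
    have h1 : (PowerSeries.C k * (L * T ^ 4)).order = 9 := by
      rw [PowerSeries.order_mul, PowerSeries.order_mul, PowerSeries.order_pow, hC k hk, hL, hT]
      rfl
    have h2 : (PowerSeries.C d * (N * T ^ 4)).order = 8 := by
      rw [PowerSeries.order_mul, PowerSeries.order_mul, PowerSeries.order_pow, hC d hd, hN, hT]
      rfl
    rw [PowerSeries.order_add_of_order_ne _ _ (by rw [h1, h2]; decide), h1, h2]
    rfl
  have hv : ∀ i : Fin 9, (v i).order = (i : ℕ) := by
    intro i
    fin_cases i <;>
      first
      | exact hlast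
      | (simp [v, PowerSeries.order_mul, PowerSeries.order_pow, hN, hL, hT] <;> rfl)
  have hN0 : N ^ 2 ≠ 0 := pow_ne_zero 2 (by rintro rfl; simp at hN)
  refine eq_zero_of_mul_mem_span v hv hN0
    (mul_mem_of_mem_span_cube ?_ ?_ ?_ ?_ ?_ ?_ ?_ ?_ ?_ ?_ hx) h
  · exact mem_span_range_of_eq 0 (show _ = N ^ 5 by ring)
  · exact mem_span_range_of_eq 1 (show _ = N ^ 4 * L by ring)
  · exact mem_span_range_of_eq 2 (show _ = N ^ 4 * T by ring)
  · exact mem_span_range_of_eq_sum ![0, 0, a, e, d, k, 0, 0, 0]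
      (by simp [Fin.sum_univ_succ, v]; linear_combination N ^ 2 * hrel)
  · exact mem_span_range_of_eq 3 (show _ = N ^ 3 * L * T by ring)
  · exact mem_span_range_of_eq 4 (show _ = N ^ 3 * T ^ 2 by ring)
  · exact mem_span_range_of_eq_sum
      ![0, 0, 0, a, e * a, d + e ^ 2, k * a + e * d, k * e + k * e, k]
      (by
        simp [Fin.sum_univ_succ, v]
        linear_combination (N * L + PowerSeries.C k * T ^ 2 + PowerSeries.C e * N * T) * hrel)
  · exact mem_span_range_of_eq_sum ![0, 0, 0, 0, a, e, d, k, 0]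
      (by simp [Fin.sum_univ_succ, v]; linear_combination N * T * hrel)
  · exact mem_span_range_of_eq 5 (show _ = N ^ 2 * L * T ^ 2 by ring)
  · exact mem_span_range_of_eq 6 (show _ = N ^ 2 * T ^ 3 by ring)

/-- The variant for a point whose tangential is a flex: the third frame vector is off the curve, so
T³ occurs, while L T² does not. The last series is then N T⁴, of order 8 with no condition on the
coefficients. -/
theorem eq_zero_of_mem_span_cube_of_nine_le_order' {N L T : PowerSeries ℂ} {a d e δ : ℂ}
    (hN : N.order = 0) (hL : L.order = 1) (hT : T.order = 2)
    (hrel : N * L ^ 2 = PowerSeries.C a * (N ^ 2 * T) + PowerSeries.C d * (N * T ^ 2) +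
      PowerSeries.C e * (N * L * T) + PowerSeries.C δ * T ^ 3)
    {x : PowerSeries ℂ} (hx : x ∈ (Submodule.span ℂ {N, L, T}) ^ 3) (h : 9 ≤ x.order) : x = 0 := by
  let v : Fin 9 → PowerSeries ℂ := ![N ^ 5, N ^ 4 * L, N ^ 4 * T, N ^ 3 * L * T, N ^ 3 * T ^ 2,
    N ^ 2 * L * T ^ 2, N ^ 2 * T ^ 3, N * L * T ^ 3, N * T ^ 4]
  have hv : ∀ i : Fin 9, (v i).order = (i : ℕ) := by
    intro i
    fin_cases i <;> simp [v, PowerSeries.order_mul, PowerSeries.order_pow, hN, hL, hT] <;> rfl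
  have hN0 : N ^ 2 ≠ 0 := pow_ne_zero 2 (by rintro rfl; simp at hN)
  refine eq_zero_of_mul_mem_span v hv hN0
    (mul_mem_of_mem_span_cube ?_ ?_ ?_ ?_ ?_ ?_ ?_ ?_ ?_ ?_ hx) h
  · exact mem_span_range_of_eq 0 (show _ = N ^ 5 by ring)
  · exact mem_span_range_of_eq 1 (show _ = N ^ 4 * L by ring)
  · exact mem_span_range_of_eq 2 (show _ = N ^ 4 * T by ring)
  · exact mem_span_range_of_eq_sum ![0, 0, a, e, d, 0, δ, 0, 0]
      (by simp [Fin.sum_univ_succ, v]; linear_combination N ^ 2 * hrel)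
  · exact mem_span_range_of_eq 3 (show _ = N ^ 3 * L * T by ring)
  · exact mem_span_range_of_eq 4 (show _ = N ^ 3 * T ^ 2 by ring)
  · exact mem_span_range_of_eq_sum ![0, 0, 0, a, e * a, d + e ^ 2, e * d, δ, e * δ]
      (by
        simp [Fin.sum_univ_succ, v]
        linear_combination (N * L + PowerSeries.C e * N * T) * hrel)
  · exact mem_span_range_of_eq_sum ![0, 0, 0, 0, a, e, d, 0, δ]
      (by simp [Fin.sum_univ_succ, v]; linear_combination N * T * hrel)
  · exact mem_span_range_of_eq 5 (show _ = N ^ 2 * L * T ^ 2 by ring)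
  · exact mem_span_range_of_eq 6 (show _ = N ^ 2 * T ^ 3 by ring)
end

/-! ### Coordinates adapted to a point of the cubic -/

noncomputable section
open MvPolynomial

/-- Coordinates `N, L, T` adapted to a point `p` of the Fermat cubic: `T = 0` is the tangent at `p`,
`q` is its third intersection with the curve, and `r` lies on the tangent `N = 0` at `q`. -/
theorem exists_frame {w : Fin 3 → PowerSeries ℂ} (hw : w 0 ^ 3 + w 1 ^ 3 + w 2 ^ 3 = 0)
    (hX : PowerSeries.X ∈ Submodule.span ℂ (Set.range w)) {p q r : Fin 3 → ℂ} {κ : ℂ} (hκ : κ ≠ 0)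
    (hwp : ∀ j, PowerSeries.constantCoeff (w j) = κ * p j)
    (hdet : (Matrix.of ![p, q, r]).det ≠ 0)
    (hppp : p 0 ^ 3 + p 1 ^ 3 + p 2 ^ 3 = 0)
    (hppq : p 0 ^ 2 * q 0 + p 1 ^ 2 * q 1 + p 2 ^ 2 * q 2 = 0)
    (hqqq : q 0 ^ 3 + q 1 ^ 3 + q 2 ^ 3 = 0)
    (hqqr : q 0 ^ 2 * r 0 + q 1 ^ 2 * r 1 + q 2 ^ 2 * r 2 = 0)
    {a b k d δ : ℂ} (ha : p 0 ^ 2 * r 0 + p 1 ^ 2 * r 1 + p 2 ^ 2 * r 2 = a)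
    (hb : p 0 * q 0 ^ 2 + p 1 * q 1 ^ 2 + p 2 * q 2 ^ 2 = b)
    (hk : q 0 * r 0 ^ 2 + q 1 * r 1 ^ 2 + q 2 * r 2 ^ 2 = k)
    (hd : p 0 * r 0 ^ 2 + p 1 * r 1 ^ 2 + p 2 * r 2 ^ 2 = d)
    (hδ : r 0 ^ 3 + r 1 ^ 3 + r 2 ^ 3 = δ) (ha0 : a ≠ 0) (hb0 : b ≠ 0) :
    ∃ (u : Fin 3 → Fin 3 → ℂ) (N L T : PowerSeries ℂ) (e : ℂ),
      N = ∑ j, PowerSeries.C (u 0 j) * w j ∧ L = ∑ j, PowerSeries.C (u 1 j) * w j ∧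
      T = ∑ j, PowerSeries.C (u 2 j) * w j ∧
      (∀ j, w j = PowerSeries.C (p j) * N + PowerSeries.C (q j) * L + PowerSeries.C (r j) * T) ∧
      Submodule.span ℂ (Set.range w) = Submodule.span ℂ {N, L, T} ∧
      N.order = 0 ∧ L.order = 1 ∧ T.order = 2 ∧
      N * L ^ 2 = PowerSeries.C (-a / b) * (N ^ 2 * T) + PowerSeries.C (-k / b) * (L * T ^ 2) +
        PowerSeries.C (-d / b) * (N * T ^ 2) + PowerSeries.C e * (N * L * T) +
        PowerSeries.C (-δ / (3 * b)) * T ^ 3 := by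
  set M : Matrix (Fin 3) (Fin 3) ℂ := Matrix.of ![p, q, r] with hM
  have hMu : IsUnit M.det := isUnit_iff_ne_zero.2 hdet
  have hinv : M⁻¹ * M = 1 := Matrix.nonsing_inv_mul M hMu
  have hinv' : M * M⁻¹ = 1 := Matrix.mul_nonsing_inv M hMu
  -- The basis dual to `p, q, r`; thus `v 0`, `v 1`, `v 2` are the coordinates of `w` in the frame.
  set u : Fin 3 → Fin 3 → ℂ := fun i j => M⁻¹ j i with hu
  set v : Fin 3 → PowerSeries ℂ := fun i => ∑ j, PowerSeries.C (u i j) * w j with hv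
  have hwv : ∀ j, w j = PowerSeries.C (p j) * v 0 + PowerSeries.C (q j) * v 1 +
      PowerSeries.C (r j) * v 2 := fun j => by
    have h1 : ∀ i, PowerSeries.C (u 0 i) * PowerSeries.C (p j) + PowerSeries.C (u 1 i) *
        PowerSeries.C (q j) + PowerSeries.C (u 2 i) * PowerSeries.C (r j) =
        if i = j then (1 : PowerSeries ℂ) else 0 := fun i => by
      have h2 := congrFun (congrFun hinv i) j
      rw [Matrix.mul_apply, Fin.sum_univ_three, Matrix.one_apply] at h2
      simp only [← map_mul, ← map_add]
      rw [show u 0 i * p j + u 1 i * q j + u 2 i * r j = if i = j then 1 else 0 from h2]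
      split_ifs <;> simp
    have h2 : w j = ∑ i, (if i = j then (1 : PowerSeries ℂ) else 0) * w i := by simp
    rw [h2]
    simp only [← h1, hv, Fin.sum_univ_three]
    ring
  have hv0 : ∀ i, PowerSeries.constantCoeff (v i) = κ * if i = 0 then 1 else 0 := fun i => by
    have h2 := congrFun (congrFun hinv' 0) i
    rw [Matrix.mul_apply, Fin.sum_univ_three, Matrix.one_apply] at h2
    have h3 : p 0 * u i 0 + p 1 * u i 1 + p 2 * u i 2 = if 0 = i then 1 else 0 := h2
    simp only [hv, Fin.sum_univ_three, map_add, map_mul, PowerSeries.constantCoeff_C, hwp]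
    rw [if_congr (eq_comm (a := i)) rfl rfl, ← h3]
    ring
  set N := v 0 with hN
  set L := v 1 with hL
  set T := v 2 with hT
  have hN0 : PowerSeries.constantCoeff N = κ := by rw [hN, hv0]; simp
  have hL0 : PowerSeries.constantCoeff L = 0 := by rw [hL, hv0]; simp
  have hT0 : PowerSeries.constantCoeff T = 0 := by rw [hT, hv0]; simp
  have hspan : Submodule.span ℂ (Set.range w) = Submodule.span ℂ {N, L, T} := by
    apply le_antisymm <;> rw [Submodule.span_le]
    · rintro _ ⟨j, rfl⟩
      rw [hwv j]
      simp only [← PowerSeries.smul_eq_C_mul]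
      exact Submodule.mem_span_triple.2 ⟨_, _, _, rfl⟩
    · have h : ∀ i, v i ∈ Submodule.span ℂ (Set.range w) := fun i => by
        refine Submodule.sum_mem _ fun j _ => ?_
        rw [← PowerSeries.smul_eq_C_mul]
        exact Submodule.smul_mem _ _ (Submodule.subset_span ⟨j, rfl⟩)
      rintro _ (rfl | rfl | rfl)
      exacts [h 0, h 1, h 2]
  set E := p 0 * q 0 * r 0 + p 1 * q 1 * r 1 + p 2 * q 2 * r 2 with hE
  have hC : ∀ {x : ℂ}, x = 0 → PowerSeries.C x = 0 := fun h => by rw [h, map_zero]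
  -- The cubic form expanded at N p + L q + T r has the polarizations as coefficients; the four
  -- incidence hypotheses remove N³, N²L, L³ and L²T.
  have hrel : 3 * (PowerSeries.C a * (N ^ 2 * T) + PowerSeries.C b * (N * L ^ 2) +
      PowerSeries.C k * (L * T ^ 2) + PowerSeries.C d * (N * T ^ 2) +
      2 * PowerSeries.C E * (N * L * T)) + PowerSeries.C δ * T ^ 3 = 0 := by
    have h1 := hC hppp
    have h2 := hC hppq
    have h3 := hC hqqq
    have h4 := hC hqqr
    rw [hwv 0, hwv 1, hwv 2] at hw
    rw [← ha, ← hb, ← hk, ← hd, ← hδ, hE]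
    simp only [map_add, map_mul, map_pow] at h1 h2 h3 h4 ⊢
    linear_combination hw - N ^ 3 * h1 - 3 * N ^ 2 * L * h2 - L ^ 3 * h3 - 3 * L ^ 2 * T * h4
  have hNo : N.order = 0 := PowerSeries.order_zero_of_unit
    (PowerSeries.isUnit_iff_constantCoeff.2 (by rw [hN0]; exact isUnit_iff_ne_zero.2 hκ))
  -- Every remaining term except N L² is divisible by T, and the cofactor B has constant term 3aκ² ≠
  -- 0.
  have hTo : T.order = 2 * L.order := by
    obtain ⟨B, hB⟩ : ∃ B, B = 3 * (PowerSeries.C a * N ^ 2 + PowerSeries.C k * L * T +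
      PowerSeries.C d * N * T + 2 * PowerSeries.C E * N * L) + PowerSeries.C δ * T ^ 2 := ⟨_, rfl⟩
    have hBo : B.order = 0 := by
      refine PowerSeries.order_zero_of_unit (PowerSeries.isUnit_iff_constantCoeff.2 ?_)
      rw [isUnit_iff_ne_zero, hB]
      simp only [map_add, map_mul, map_pow, hN0, hL0, hT0, PowerSeries.constantCoeff_C, map_ofNat]
      simp [ha0, hκ]
    have hbo : (PowerSeries.C (-3 * b)).order = 0 := PowerSeries.order_zero_of_unit
      ((isUnit_iff_ne_zero.2 (mul_ne_zero (by norm_num) hb0)).map _)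
    have h1 : T * B = PowerSeries.C (-3 * b) * (N * L ^ 2) := by
      simp only [hB, map_mul, map_neg, map_ofNat]
      linear_combination hrel
    have h2 := congrArg PowerSeries.order h1
    rw [PowerSeries.order_mul, PowerSeries.order_mul, PowerSeries.order_mul, PowerSeries.order_pow,
      hNo, hBo, hbo, add_zero, zero_add, zero_add, nsmul_eq_mul] at h2
    exact h2
  -- If L had order at least 2, so would T. In an expression of X through N, L, T the constant term
  -- forces the coefficient of N to be 0, and then nothing has order 1.
  have hLo : L.order = 1 := by
    have h1 : 1 ≤ L.order := PowerSeries.one_le_order_iff_constCoeff_eq_zero.2 hL0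
    refine le_antisymm (not_lt.1 fun h2 => ?_) h1
    rw [hspan] at hX
    obtain ⟨x, y, z, hxyz⟩ := Submodule.mem_span_triple.1 hX
    have h3 := congrArg PowerSeries.constantCoeff hxyz
    simp only [PowerSeries.smul_eq_C_mul, map_add, map_mul, PowerSeries.constantCoeff_C, hN0, hL0,
      hT0, PowerSeries.constantCoeff_X, mul_zero, add_zero, mul_eq_zero, hκ, or_false] at h3
    have h4 := congrArg (PowerSeries.coeff 1) hxyz
    have h5 : PowerSeries.coeff 1 L = 0 := PowerSeries.coeff_of_lt_order 1 (by exact_mod_cast h2)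
    have h6 : PowerSeries.coeff 1 T = 0 := PowerSeries.coeff_of_lt_order 1 (by
      rw [hTo, two_mul]
      exact lt_of_lt_of_le (by exact_mod_cast h2) le_self_add)
    rw [map_add, map_add, map_smul, map_smul, map_smul, h3, h5, h6, PowerSeries.coeff_one_X] at h4
    simp at h4
  refine ⟨u, N, L, T, -2 * E / b, rfl, rfl, rfl, hwv, hspan, hNo, hLo, by rw [hTo, hLo]; rfl, ?_⟩
  have hinvb : PowerSeries.C b * PowerSeries.C b⁻¹ = (1 : PowerSeries ℂ) := by
    rw [← map_mul, mul_inv_cancel₀ hb0, map_one]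
  have hinv3 : 3 * PowerSeries.C (3 : ℂ)⁻¹ = (1 : PowerSeries ℂ) := by
    rw [← map_ofNat PowerSeries.C, ← map_mul, mul_inv_cancel₀ (by norm_num), map_one]
  simp only [div_eq_mul_inv, mul_inv, map_mul, map_neg, map_ofNat]
  linear_combination PowerSeries.C b⁻¹ * PowerSeries.C (3 : ℂ)⁻¹ * hrel - N * L ^ 2 * hinvb -
    PowerSeries.C b⁻¹ * (PowerSeries.C a * (N ^ 2 * T) + PowerSeries.C b * (N * L ^ 2) +
      PowerSeries.C k * (L * T ^ 2) + PowerSeries.C d * (N * T ^ 2) +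
      2 * PowerSeries.C E * (N * L * T)) * hinv3
end

/-! ### Tangentials and the degree-8 condition -/

noncomputable section
open MvPolynomial

/-- The third intersection with the Fermat cubic of its tangent line at `v`. -/
def tangential (v : Fin 3 → ℂ) : Fin 3 → ℂ :=
  ![v 0 * (v 1 ^ 3 - v 2 ^ 3), v 1 * (v 2 ^ 3 - v 0 ^ 3), v 2 * (v 0 ^ 3 - v 1 ^ 3)]

/-- This vanishes if and only if `v` lies on the tangent line to the Fermat cubic at the second
tangential of `v`. -/
def nineForm (v : Fin 3 → ℂ) : ℂ :=
  v 0 * tangential (tangential v) 0 ^ 2 + v 1 * tangential (tangential v) 1 ^ 2 +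
    v 2 * tangential (tangential v) 2 ^ 2

@[simp] theorem tangential_zero (v : Fin 3 → ℂ) :
    tangential v 0 = v 0 * (v 1 ^ 3 - v 2 ^ 3) := rfl
@[simp] theorem tangential_one (v : Fin 3 → ℂ) :
    tangential v 1 = v 1 * (v 2 ^ 3 - v 0 ^ 3) := rfl
@[simp] theorem tangential_two (v : Fin 3 → ℂ) :
    tangential v 2 = v 2 * (v 0 ^ 3 - v 1 ^ 3) := rfl

variable {v : Fin 3 → ℂ}

theorem tangential_fermat (hv : v 0 ^ 3 + v 1 ^ 3 + v 2 ^ 3 = 0) :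
    tangential v 0 ^ 3 + tangential v 1 ^ 3 + tangential v 2 ^ 3 = 0 := by
  simp only [tangential_zero, tangential_one, tangential_two, mul_pow]
  generalize v 0 ^ 3 = a, v 1 ^ 3 = b, v 2 ^ 3 = c at *
  obtain rfl : c = -a - b := by linear_combination hv
  ring

theorem sq_dot_tangential (v : Fin 3 → ℂ) :
    v 0 ^ 2 * tangential v 0 + v 1 ^ 2 * tangential v 1 + v 2 ^ 2 * tangential v 2 = 0 := by
  simp only [tangential_zero, tangential_one, tangential_two]
  ring

/-- This is the frame coefficient `b`, nonzero off the coordinate triangle; applied to `tangential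
v` it gives `k`. As in the neighbouring lemmas, on the cubes it becomes a polynomial identity after
eliminating c = -a - b. -/
theorem dot_tangential_sq (hv : v 0 ^ 3 + v 1 ^ 3 + v 2 ^ 3 = 0) :
    v 0 * tangential v 0 ^ 2 + v 1 * tangential v 1 ^ 2 + v 2 * tangential v 2 ^ 2 =
      -9 * (v 0 * v 1 * v 2) ^ 3 := by
  have key : ∀ a b c : ℂ, a + b + c = 0 → a * (b - c) ^ 2 + b * (c - a) ^ 2 + c * (a - b) ^ 2 =
      -9 * (a * b * c) := by
    intro a b c h
    obtain rfl : c = -a - b := by linear_combination h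
    ring
  simp only [tangential_zero, tangential_one, tangential_two]
  linear_combination key _ _ _ hv

/-- This is the frame coefficient `a`. For `v` off the triangle it vanishes exactly when `tangential
v` has a zero coordinate, that is when two cubes agree. -/
theorem sq_dot_tangential_tangential (hv : v 0 ^ 3 + v 1 ^ 3 + v 2 ^ 3 = 0) :
    v 0 ^ 2 * tangential (tangential v) 0 + v 1 ^ 2 * tangential (tangential v) 1 +
      v 2 ^ 2 * tangential (tangential v) 2 = -9 * (v 0 * v 1 * v 2) ^ 3 *
        ((v 0 ^ 3 - v 1 ^ 3) * (v 1 ^ 3 - v 2 ^ 3) * (v 2 ^ 3 - v 0 ^ 3)) := by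
  have key : ∀ a b c : ℂ, a + b + c = 0 →
      a * (b - c) * (b * (c - a) ^ 3 - c * (a - b) ^ 3) +
      b * (c - a) * (c * (a - b) ^ 3 - a * (b - c) ^ 3) +
      c * (a - b) * (a * (b - c) ^ 3 - b * (c - a) ^ 3) =
      -9 * (a * b * c) * ((a - b) * (b - c) * (c - a)) := by
    intro a b c h
    obtain rfl : c = -a - b := by linear_combination h
    ring
  simp only [tangential_zero, tangential_one, tangential_two]
  linear_combination key _ _ _ hv

/-- Off the triangle the condition is a binary form of degree 8 in the cubes: a symmetric quadratic
times two cubics which the swap of a and b exchanges up to sign. -/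
theorem nineForm_eq (hv : v 0 ^ 3 + v 1 ^ 3 + v 2 ^ 3 = 0) :
    nineForm v = 27 * (v 0 * v 1 * v 2) ^ 3 * (v 0 ^ 6 + v 0 ^ 3 * v 1 ^ 3 + v 1 ^ 6) *
      (v 1 ^ 9 + 6 * v 1 ^ 6 * v 0 ^ 3 + 3 * v 1 ^ 3 * v 0 ^ 6 - v 0 ^ 9) *
      (v 1 ^ 9 - 3 * v 1 ^ 6 * v 0 ^ 3 - 6 * v 1 ^ 3 * v 0 ^ 6 - v 0 ^ 9) := by
  have key : ∀ a b c : ℂ, a + b + c = 0 →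
      a * (b - c) ^ 2 * (b * (c - a) ^ 3 - c * (a - b) ^ 3) ^ 2 +
      b * (c - a) ^ 2 * (c * (a - b) ^ 3 - a * (b - c) ^ 3) ^ 2 +
      c * (a - b) ^ 2 * (a * (b - c) ^ 3 - b * (c - a) ^ 3) ^ 2 =
      27 * (a * b * c) * (a ^ 2 + a * b + b ^ 2) * (b ^ 3 + 6 * b ^ 2 * a + 3 * b * a ^ 2 - a ^ 3) *
        (b ^ 3 - 3 * b ^ 2 * a - 6 * b * a ^ 2 - a ^ 3) := by
    intro a b c h
    obtain rfl : c = -a - b := by linear_combination h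
    ring
  have := key _ _ _ hv
  simp only [nineForm, tangential_zero, tangential_one, tangential_two]
  linear_combination this

theorem det_tangential (hv : v 0 ^ 3 + v 1 ^ 3 + v 2 ^ 3 = 0) :
    (Matrix.of ![v, tangential v, tangential (tangential v)]).det = -27 * (v 0 * v 1 * v 2) ^ 4 *
        ((v 0 ^ 3 - v 1 ^ 3) * (v 1 ^ 3 - v 2 ^ 3) * (v 2 ^ 3 - v 0 ^ 3)) := by
  have key : ∀ a b c : ℂ, a + b + c = 0 →
      (c - a) * (a - b) * (a * (b - c) ^ 3 - b * (c - a) ^ 3) -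
        (a - b) * (c - a) * (c * (a - b) ^ 3 - a * (b - c) ^ 3) +
      ((a - b) * (b - c) * (b * (c - a) ^ 3 - c * (a - b) ^ 3) -
        (b - c) * (a - b) * (a * (b - c) ^ 3 - b * (c - a) ^ 3)) +
      ((b - c) * (c - a) * (c * (a - b) ^ 3 - a * (b - c) ^ 3) -
        (c - a) * (b - c) * (b * (c - a) ^ 3 - c * (a - b) ^ 3)) =
      -27 * (a * b * c) * ((a - b) * (b - c) * (c - a)) := by
    intro a b c h
    obtain rfl : c = -a - b := by linear_combination h
    ring
  have := key _ _ _ hv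
  rw [Matrix.det_fin_three]
  simp only [Matrix.of_apply, Matrix.cons_val_zero, Matrix.cons_val_one, Matrix.cons_val,
    tangential_zero, tangential_one, tangential_two]
  linear_combination (v 0 * v 1 * v 2) * this

/-- The points of the Fermat cubic outside the coordinate triangle. -/
structure IsGeneralFermat (v : Fin 3 → ℂ) : Prop where
  fermat : v 0 ^ 3 + v 1 ^ 3 + v 2 ^ 3 = 0
  zero : v 0 ≠ 0
  one : v 1 ≠ 0
  two : v 2 ≠ 0

theorem IsGeneralFermat.mul_ne_zero (hv : IsGeneralFermat v) : v 0 * v 1 * v 2 ≠ 0 :=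
  _root_.mul_ne_zero (_root_.mul_ne_zero hv.zero hv.one) hv.two

variable {w : Fin 3 → PowerSeries ℂ} {κ : ℂ}

/-- The frame given by a point and its first two tangentials. -/
theorem exists_tangential_frame (hw : w 0 ^ 3 + w 1 ^ 3 + w 2 ^ 3 = 0)
    (hX : PowerSeries.X ∈ Submodule.span ℂ (Set.range w)) (hκ : κ ≠ 0)
    (hwv : ∀ j, PowerSeries.constantCoeff (w j) = κ * v j) (hv : IsGeneralFermat v)
    (hne : (v 0 ^ 3 - v 1 ^ 3) * (v 1 ^ 3 - v 2 ^ 3) * (v 2 ^ 3 - v 0 ^ 3) ≠ 0) :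
    ∃ (u : Fin 3 → Fin 3 → ℂ) (N L T : PowerSeries ℂ) (a k c e : ℂ),
      N = ∑ j, PowerSeries.C (u 0 j) * w j ∧ L = ∑ j, PowerSeries.C (u 1 j) * w j ∧
      T = ∑ j, PowerSeries.C (u 2 j) * w j ∧
      (∀ j, w j = PowerSeries.C (v j) * N + PowerSeries.C (tangential v j) * L +
        PowerSeries.C (tangential (tangential v) j) * T) ∧
      Submodule.span ℂ (Set.range w) = Submodule.span ℂ {N, L, T} ∧
      N.order = 0 ∧ L.order = 1 ∧ T.order = 2 ∧ k ≠ 0 ∧ c ≠ 0 ∧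
      N * L ^ 2 = PowerSeries.C a * (N ^ 2 * T) + PowerSeries.C k * (L * T ^ 2) +
        PowerSeries.C (c * nineForm v) * (N * T ^ 2) + PowerSeries.C e * (N * L * T) := by
  have hP := hv.mul_ne_zero
  have hb0 : -9 * (v 0 * v 1 * v 2) ^ 3 ≠ 0 := by simp [hv.zero, hv.one, hv.two]
  have hk : tangential v 0 * tangential v 1 * tangential v 2 ≠ 0 := by
    simp only [tangential_zero, tangential_one, tangential_two]
    convert _root_.mul_ne_zero hP hne using 1
    ring
  have hk0 : -9 * (tangential v 0 * tangential v 1 * tangential v 2) ^ 3 ≠ 0 :=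
    _root_.mul_ne_zero (by norm_num) (pow_ne_zero 3 hk)
  have ht := tangential_fermat hv.fermat
  obtain ⟨u, N, L, T, e, hN, hL, hT, huw, hspan, hNo, hLo, hTo, hrel⟩ :=
    exists_frame hw hX hκ hwv
      (by rw [det_tangential hv.fermat]
          exact _root_.mul_ne_zero (_root_.mul_ne_zero (by norm_num) (pow_ne_zero 4 hP)) hne)
      hv.fermat (sq_dot_tangential v) ht (sq_dot_tangential _)
      (sq_dot_tangential_tangential hv.fermat) (dot_tangential_sq hv.fermat)
      (dot_tangential_sq ht) rfl (tangential_fermat ht)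
      (_root_.mul_ne_zero (_root_.mul_ne_zero (by norm_num) (pow_ne_zero 3 hP)) hne) hb0
  rw [neg_zero, zero_div, map_zero, zero_mul, add_zero,
    show -(v 0 * tangential (tangential v) 0 ^ 2 + v 1 * tangential (tangential v) 1 ^ 2 +
      v 2 * tangential (tangential v) 2 ^ 2) / (-9 * (v 0 * v 1 * v 2) ^ 3) =
      -1 / (-9 * (v 0 * v 1 * v 2) ^ 3) * nineForm v by rw [nineForm]; ring] at hrel
  exact ⟨u, N, L, T, _, _, _, e, hN, hL, hT, huw, hspan, hNo, hLo,
    hTo, div_ne_zero (neg_ne_zero.2 hk0) hb0, div_ne_zero (by norm_num) hb0, hrel⟩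

/-- At a general point that does not lie on the tangent at its second tangential, no cubic meets
the Fermat cubic to order exactly nine. -/
theorem eq_zero_of_nineForm_ne_zero (hw : w 0 ^ 3 + w 1 ^ 3 + w 2 ^ 3 = 0)
    (hX : PowerSeries.X ∈ Submodule.span ℂ (Set.range w)) (hκ : κ ≠ 0)
    (hwv : ∀ j, PowerSeries.constantCoeff (w j) = κ * v j) (hv : IsGeneralFermat v)
    (hD : nineForm v ≠ 0) {x : PowerSeries ℂ} (hx : x ∈ Submodule.span ℂ (Set.range w) ^ 3)
    (h9 : 9 ≤ x.order) : x = 0 := by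
  have h0 := hv.zero
  have h1 := hv.one
  have h2 := hv.two
  have key : ∀ q r : Fin 3 → ℂ, (Matrix.of ![v, q, r]).det ≠ 0 →
      v 0 ^ 2 * q 0 + v 1 ^ 2 * q 1 + v 2 ^ 2 * q 2 = 0 → q 0 ^ 3 + q 1 ^ 3 + q 2 ^ 3 = 0 →
      q 0 ^ 2 * r 0 + q 1 ^ 2 * r 1 + q 2 ^ 2 * r 2 = 0 →
      v 0 ^ 2 * r 0 + v 1 ^ 2 * r 1 + v 2 ^ 2 * r 2 ≠ 0 →
      v 0 * q 0 ^ 2 + v 1 * q 1 ^ 2 + v 2 * q 2 ^ 2 ≠ 0 →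
      q 0 * r 0 ^ 2 + q 1 * r 1 ^ 2 + q 2 * r 2 ^ 2 = 0 → x = 0 := by
    intro q r hdet hppq hqqq hqqr ha hb hk
    obtain ⟨u, N, L, T, e, -, -, -, -, hspan, hNo, hLo, hTo, hrel⟩ :=
      exists_frame hw hX hκ hwv hdet hv.fermat hppq hqqq hqqr rfl rfl hk rfl rfl ha hb
    rw [neg_zero, zero_div, map_zero, zero_mul, add_zero] at hrel
    rw [hspan] at hx
    exact eq_zero_of_mem_span_cube_of_nine_le_order' hNo hLo hTo hrel hx h9
  -- If two cubes agree, the tangential is a flex and equals its own tangential, so the three points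
  -- are no frame. The third vector is then the coordinate vertex opposite the zero coordinate of
  -- the flex `q`, which makes both q²·r and q·r² vanish.
  by_cases hne : (v 0 ^ 3 - v 1 ^ 3) * (v 1 ^ 3 - v 2 ^ 3) * (v 2 ^ 3 - v 0 ^ 3) = 0
  · rw [mul_eq_zero, mul_eq_zero, sub_eq_zero, sub_eq_zero, sub_eq_zero] at hne
    rcases hne with (h | h) | h
    · refine key ![v 0, -v 1, 0] ![0, 0, 1] ?_ ?_ ?_ ?_ ?_ ?_ ?_ <;>
        simp [Matrix.det_fin_three]
      · exact fun h' => _root_.mul_ne_zero h0 h1 (by linear_combination -1 * h' / 2)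
      · linear_combination h
      · linear_combination h
      · exact h2
      · exact fun h' => pow_ne_zero 3 h0 (by linear_combination (h' + h) / 2)
    · refine key ![0, v 1, -v 2] ![1, 0, 0] ?_ ?_ ?_ ?_ ?_ ?_ ?_ <;>
        simp [Matrix.det_fin_three]
      · exact fun h' => _root_.mul_ne_zero h1 h2 (by linear_combination -1 * h' / 2)
      · linear_combination h
      · linear_combination h
      · exact h0
      · exact fun h' => pow_ne_zero 3 h1 (by linear_combination (h' + h) / 2)
    · refine key ![-v 0, 0, v 2] ![0, 1, 0] ?_ ?_ ?_ ?_ ?_ ?_ ?_ <;>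
        simp [Matrix.det_fin_three]
      · exact fun h' => _root_.mul_ne_zero h2 h0 (by linear_combination -1 * h' / 2)
      · linear_combination h
      · linear_combination h
      · exact h1
      · exact fun h' => pow_ne_zero 3 h2 (by linear_combination (h' + h) / 2)
  · obtain ⟨u, N, L, T, a, k, c, e, -, -, -, -, hspan, hNo, hLo, hTo, hk, hc, hrel⟩ :=
      exists_tangential_frame hw hX hκ hwv hv hne
    rw [hspan] at hx
    exact eq_zero_of_mem_span_cube_of_nine_le_order hNo hLo hTo hrel hk
      (_root_.mul_ne_zero hc hD) hx h9

/-- At a general point on the tangent at its second tangential, lines meet the Fermat cubic to order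
at most two, conics to order at most five, and some cubic to order nine. -/
theorem exists_cubic_of_nineForm_eq_zero (hw : w 0 ^ 3 + w 1 ^ 3 + w 2 ^ 3 = 0)
    (hX : PowerSeries.X ∈ Submodule.span ℂ (Set.range w)) (hκ : κ ≠ 0)
    (hwv : ∀ j, PowerSeries.constantCoeff (w j) = κ * v j) (hv : IsGeneralFermat v)
    (hD : nineForm v = 0) : LinearIndependent ℂ w ∧
      (∀ x ∈ Submodule.span ℂ (Set.range w), 3 ≤ x.order → x = 0) ∧
      (∀ x ∈ Submodule.span ℂ (Set.range w) ^ 2, 6 ≤ x.order → x = 0) ∧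
      ∃ G : MvPolynomial (Fin 3) ℂ, G.IsHomogeneous 3 ∧ (aeval w G).order = 9 := by
  have hne : (v 0 ^ 3 - v 1 ^ 3) * (v 1 ^ 3 - v 2 ^ 3) * (v 2 ^ 3 - v 0 ^ 3) ≠ 0 := by
    intro h
    -- With two of a, b, c equal, the octic collapses to -243 times an eighth power.
    have key : ∀ a b c : ℂ, a + b + c = 0 → (a - b) * (b - c) * (c - a) = 0 → a ≠ 0 → b ≠ 0 →
        (a ^ 2 + a * b + b ^ 2) * (b ^ 3 + 6 * b ^ 2 * a + 3 * b * a ^ 2 - a ^ 3) *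
        (b ^ 3 - 3 * b ^ 2 * a - 6 * b * a ^ 2 - a ^ 3) ≠ 0 := by
      intro a b c h1 h2 ha hb h3
      rw [mul_eq_zero, mul_eq_zero, sub_eq_zero, sub_eq_zero, sub_eq_zero] at h2
      rcases h2 with (rfl | rfl) | rfl
      · exact ha (pow_eq_zero_iff (n := 8) (by norm_num) |>.1 (by linear_combination -h3 / 243))
      · obtain rfl : a = -2 * b := by linear_combination h1
        exact hb (pow_eq_zero_iff (n := 8) (by norm_num) |>.1 (by linear_combination -h3 / 243))
      · obtain rfl : b = -2 * c := by linear_combination h1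
        exact ha (pow_eq_zero_iff (n := 8) (by norm_num) |>.1 (by linear_combination -h3 / 243))
    have h1 := nineForm_eq hv.fermat
    rw [hD, eq_comm, mul_assoc, mul_assoc, mul_eq_zero] at h1
    refine key _ _ _ hv.fermat h (pow_ne_zero 3 hv.zero) (pow_ne_zero 3 hv.one) ?_
    have h2 := h1.resolve_left (_root_.mul_ne_zero (by norm_num) (pow_ne_zero 3 hv.mul_ne_zero))
    linear_combination h2
  obtain ⟨u, N, L, T, a, k, c, e, hN, hL, hT, -, hspan, hNo, hLo, hTo, hk, hc, hrel⟩ :=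
      exists_tangential_frame hw hX hκ hwv hv hne
  rw [hD, mul_zero, map_zero, zero_mul, add_zero] at hrel
  have hlin : ∀ x ∈ Submodule.span ℂ {N, L, T}, 3 ≤ x.order → x = 0 := fun x hx h =>
    eq_zero_of_mem_span_of_three_le_order hNo hLo hTo hx h
  rw [hspan]
  refine ⟨?_, hlin, fun x hx h => eq_zero_of_mem_span_sq_of_six_le_order hNo hLo hTo hrel hx h, ?_⟩
  · have hli : LinearIndependent ℂ ![N, L, T] := by
      rw [Fintype.linearIndependent_iff]
      intro c hc i
      rw [coeffs_eq_zero_of_le_order ![N, L, T] (fun i => by fin_cases i <;> simp [hNo, hLo, hTo]) c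
        (by rw [hc, PowerSeries.order_zero]; exact le_top)]
      rfl
    have hrange : Set.range ![N, L, T] = {N, L, T} := by
      simp only [Matrix.range_cons, Matrix.range_empty, Set.union_empty, Set.singleton_union]
    have h1 := finrank_span_eq_card hli
    rw [hrange, ← hspan] at h1
    exact linearIndependent_iff_card_eq_finrank_span.2 h1.symm
  · let ℓ : Fin 3 → MvPolynomial (Fin 3) ℂ := fun i => ∑ j, C (u i j) * X j
    have hℓ : ∀ i, (ℓ i).IsHomogeneous 1 := fun i =>
      IsHomogeneous.sum _ _ _ fun j _ => isHomogeneous_C_mul_X _ j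
    have hC : ∀ c : ℂ, aeval w (C c) = PowerSeries.C c := fun c => algHom_C _ c
    have hℓw : ∀ i, aeval w (ℓ i) = ∑ j, PowerSeries.C (u i j) * w j := fun i => by
      simp only [ℓ, map_sum, map_mul, aeval_X, hC]
    -- Found by reducing N²L³ with the relation until, apart from multiples of N², only k² L T⁴ is
    -- left: N² G = k² L T⁴, of order 1 + 8 = 9.
    let G := ℓ 1 ^ 3 - C a * (ℓ 0 * ℓ 1 * ℓ 2) - C (k * a) * ℓ 2 ^ 3 - C (2 * e) * (ℓ 1 ^ 2 * ℓ 2) +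
      C (a * e) * (ℓ 0 * ℓ 2 ^ 2) + C (e ^ 2) * (ℓ 1 * ℓ 2 ^ 2)
    refine ⟨G, ?_, ?_⟩
    · have h1 : ∀ c x y z, (C c * (ℓ x * ℓ y * ℓ z)).IsHomogeneous 3 := fun c x y z => by
        simpa using (isHomogeneous_C (Fin 3) c).mul (((hℓ x).mul (hℓ y)).mul (hℓ z))
      have h2 : G = C 1 * (ℓ 1 * ℓ 1 * ℓ 1) + C (-a) * (ℓ 0 * ℓ 1 * ℓ 2) +
          C (-(k * a)) * (ℓ 2 * ℓ 2 * ℓ 2) + C (-(2 * e)) * (ℓ 1 * ℓ 1 * ℓ 2) +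
          C (a * e) * (ℓ 0 * ℓ 2 * ℓ 2) + C (e ^ 2) * (ℓ 1 * ℓ 2 * ℓ 2) := by
        simp only [G, map_neg, map_one]
        ring
      rw [h2]
      exact (((((h1 _ _ _ _).add (h1 _ _ _ _)).add (h1 _ _ _ _)).add (h1 _ _ _ _)).add
        (h1 _ _ _ _)).add (h1 _ _ _ _)
    · have h1 : N ^ 2 * aeval w G = PowerSeries.C (k ^ 2) * (L * T ^ 4) := by
        simp only [G, map_add, map_sub, map_mul, map_pow, hC, hℓw, ← hN, ← hL, ← hT, map_ofNat]
        linear_combination (N * L + PowerSeries.C k * T ^ 2 - PowerSeries.C e * N * T) * hrel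
      have h2 := congrArg PowerSeries.order h1
      rw [PowerSeries.order_mul, PowerSeries.order_mul, PowerSeries.order_mul,
        PowerSeries.order_pow, PowerSeries.order_pow, hNo, hLo, hTo,
        PowerSeries.order_zero_of_unit ((isUnit_iff_ne_zero.2 (pow_ne_zero 2 hk)).map _)] at h2
      simp only [nsmul_eq_mul, mul_zero, zero_add] at h2
      rw [h2]
      rfl
end

/-! ### Type-9 points are the zeros of the degree-8 condition -/

noncomputable section
open MvPolynomial

/-- A cubic that meets F to order at least 9 where `nineForm` is nonzero vanishes along the whole
branch, so its multiplicity is infinite and not 9. Where `nineForm` vanishes, the bounds on lines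
and conics exclude both a flex and a factorization of the cubic. -/
theorem isTypeNine_iff (P : ProjPlane) :
    IsTypeNine P ↔ IsGeneralFermat P.rep ∧ nineForm P.rep = 0 := by
  constructor
  · rintro ⟨hP, hflex, G, hG, -, hmult⟩
    have hv : IsGeneralFermat P.rep :=
      ⟨by simpa [OnCurve, fermatCubic] using hP,
        fun h => hflex (isFlex_of_coord_eq_zero P hP _ h),
        fun h => hflex (isFlex_of_coord_eq_zero P hP _ h),
        fun h => hflex (isFlex_of_coord_eq_zero P hP _ h)⟩
    refine ⟨hv, by_contra fun hD => ?_⟩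
    obtain ⟨w, hI, hw, ⟨i, hi⟩, ⟨κ, hκ, hwv⟩, hX⟩ := exists_parametrization P hP
    rw [hI] at hmult
    have hmem := aeval_mem_pow (Submodule.span ℂ (Set.range w))
      (Submodule.subset_span ⟨i, hi⟩) w (fun j => Submodule.subset_span ⟨j, rfl⟩) G 3
      hG.totalDegree_le
    rw [eq_zero_of_nineForm_ne_zero hw hX hκ hwv hv hD hmem hmult.ge,
      PowerSeries.order_zero] at hmult
    exact absurd hmult (by decide)
  · rintro ⟨hv, hD⟩
    have hP : OnCurve fermatCubic P := by simpa [OnCurve, fermatCubic] using hv.fermat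
    obtain ⟨w, hI, hw, ⟨i, hi⟩, ⟨κ, hκ, hwv⟩, hX⟩ := exists_parametrization P hP
    obtain ⟨hli, hV1, hV2, G, hG, hG9⟩ := exists_cubic_of_nineForm_eq_zero hw hX hκ hwv hv hD
    have hmem := aeval_mem_pow (Submodule.span ℂ (Set.range w))
      (Submodule.subset_span ⟨i, hi⟩) w (fun j => Submodule.subset_span ⟨j, rfl⟩)
    refine ⟨hP, ?_, G, hG, ?_, by rw [hI, hG9]⟩
    · rintro ⟨-, M, hM, hM0, h3⟩
      rw [hI] at h3
      have h0 := hV1 _ (by simpa using hmem M 1 hM.totalDegree_le) h3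
      rw [← mem_homogeneousSubmodule, homogeneousSubmodule_one_eq_span_X,
        Submodule.mem_span_range_iff_exists_fun] at hM
      obtain ⟨c, rfl⟩ := hM
      simp only [map_sum, map_smul, aeval_X] at h0
      exact hM0 (Finset.sum_eq_zero fun j _ => by
        rw [Fintype.linearIndependent_iff.1 hli c h0 j, zero_smul])
    -- A linear factor contributes order at most 2 and its cofactor at most 5, short of 9. The
    -- factors need not be known to be homogeneous: one coordinate of `w` is 1, so the bounds cover
    -- all polynomials of the given degree.
    · have hfactor : ∀ A B : MvPolynomial (Fin 3) ℂ, (aeval w A).order + (aeval w B).order = 9 →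
          A.totalDegree + B.totalDegree = 3 → A.totalDegree ≤ 1 → IsUnit A := by
        intro A B hAB hdeg hA
        have hA0 : A ≠ 0 := by
          rintro rfl
          rw [map_zero, PowerSeries.order_zero, top_add] at hAB
          exact absurd hAB (by decide)
        rcases Nat.le_one_iff_eq_zero_or_eq_one.1 hA with h | h
        · rw [totalDegree_eq_zero_iff_eq_C] at h
          rw [h] at hA0 ⊢
          exact (isUnit_iff_ne_zero.2 fun h' => hA0 (by rw [h', map_zero])).map C
        · exfalso
          have h1 : (aeval w A).order < 3 := not_le.1 fun h3 => by
            rw [hV1 _ (by simpa using hmem A 1 h.le) h3, PowerSeries.order_zero, top_add] at hAB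
            exact absurd hAB (by decide)
          have h2 : (aeval w B).order < 6 := not_le.1 fun h3 => by
            rw [hV2 _ (hmem B 2 (by omega)) h3, PowerSeries.order_zero, add_top] at hAB
            exact absurd hAB (by decide)
          have h3 := ENat.add_lt_add h1 h2
          rw [hAB] at h3
          exact absurd h3 (by decide)
      have hG0 : G ≠ 0 := by
        rintro rfl
        rw [map_zero, PowerSeries.order_zero] at hG9
        exact absurd hG9 (by decide)
      refine ⟨fun hu => ?_, fun {A B} hAB => ?_⟩
      · rw [PowerSeries.order_zero_of_unit (hu.map (aeval w))] at hG9
        exact absurd hG9 (by decide)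
      · rw [hAB, map_mul, PowerSeries.order_mul] at hG9
        have hA0 : A ≠ 0 := by rintro rfl; exact hG0 (by rw [hAB, zero_mul])
        have hB0 : B ≠ 0 := by rintro rfl; exact hG0 (by rw [hAB, mul_zero])
        have hdeg := hG.totalDegree hG0
        rw [hAB, totalDegree_mul_of_isDomain hA0 hB0] at hdeg
        rcases Nat.lt_or_ge A.totalDegree 2 with h | h
        · exact Or.inl (hfactor A B hG9 hdeg (by omega))
        · exact Or.inr (hfactor B A (by rw [add_comm, hG9]) (by omega) (by omega))
end

/-! ### The group law and torsion through tangentials -/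

noncomputable section
open MvPolynomial

theorem hasCoords_iff {P : ProjPlane} {v v' : Fin 3 → ℂ} (hv : HasCoords P v) :
    HasCoords P v' ↔ ∃ c : ℂ, c ≠ 0 ∧ v' = c • v := by
  obtain ⟨hv0, rfl⟩ := hv
  constructor
  · rintro ⟨hv', h⟩
    obtain ⟨a, ha⟩ := (Projectivization.mk_eq_mk_iff' ℂ _ _ hv' hv0).1 h
    refine ⟨a, ?_, ha.symm⟩
    rintro rfl
    exact hv' (by rw [← ha, zero_smul])
  · rintro ⟨c, hc, rfl⟩
    exact ⟨smul_ne_zero hc hv0, (Projectivization.mk_eq_mk_iff' ℂ _ _ _ hv0).2 ⟨c, rfl⟩⟩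

theorem hasCoords_rep (P : ProjPlane) : HasCoords P P.rep := ⟨P.rep_nonzero, P.mk_rep⟩

theorem HasCoords.eq {P P' : ProjPlane} {v : Fin 3 → ℂ} (h : HasCoords P v) (h' : HasCoords P' v) :
    P = P' := by
  obtain ⟨_, rfl⟩ := h
  obtain ⟨_, rfl⟩ := h'
  rfl

theorem tangential_smul (c : ℂ) (v : Fin 3 → ℂ) : tangential (c • v) = c ^ 4 • tangential v := by
  funext i
  fin_cases i <;> simp [tangential] <;> ring

/-- The fraction 3x²/(2y) is the slope ℓ of the tangent at (x, y), and the right side is the point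
-2(x, y) before the final reflection of the doubling formula; 8y³ clears the denominators. -/
theorem tangential_fermatVec {x y : ℂ} (h : y ^ 2 = x ^ 3 - 432) (hy : y ≠ 0) :
    tangential (fermatVec x y 1) = (8 * y ^ 3) • fermatVec ((3 * x ^ 2 / (2 * y)) ^ 2 - 2 * x)
      (3 * x ^ 2 / (2 * y) * ((3 * x ^ 2 / (2 * y)) ^ 2 - 2 * x - x) + y) 1 := by
  have hℓ : 2 * y * (3 * x ^ 2 / (2 * y)) = 3 * x ^ 2 := by field_simp
  generalize 3 * x ^ 2 / (2 * y) = ℓ at *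
  have h3 : 8 * y ^ 3 * (ℓ * (ℓ ^ 2 - 2 * x - x)) = 27 * x ^ 6 - 36 * x ^ 3 * y ^ 2 := by
    linear_combination (4 * y ^ 2 * ℓ ^ 2 + 6 * x ^ 2 * y * ℓ + 9 * x ^ 4 - 12 * x * y ^ 2) * hℓ
  have h2 : 8 * y ^ 3 * (ℓ ^ 2 - 2 * x) = 18 * x ^ 4 * y - 16 * x * y ^ 3 := by
    linear_combination (4 * y ^ 2 * ℓ + 6 * x ^ 2 * y) * hℓ
  funext i
  fin_cases i
  · simp [tangential, fermatVec]
    linear_combination -h3 - (-27 * x ^ 3 + 9 * y ^ 2 + 216 * y - 3888) * h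
  · simp [tangential, fermatVec]
    linear_combination h3 + (-27 * x ^ 3 + 9 * y ^ 2 - 216 * y - 3888) * h
  · simp [tangential, fermatVec]
    linear_combination -6 * h2 + 108 * x * y * h

/-- The point `-2Q` is the third intersection of the tangent at `Q`. -/
theorem hasCoords_neg_two_nsmul (Q : fermatWeierstrass.Point) {v : Fin 3 → ℂ}
    (hv : HasCoords (fermatOfWeierstrass Q).1 v) :
    HasCoords (fermatOfWeierstrass (-(2 • Q))).1 (tangential v) := by
  -- One coordinate vector is enough, since `tangential` is homogeneous of degree 4.
  suffices h : ∃ v', HasCoords (fermatOfWeierstrass Q).1 v' ∧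
      HasCoords (fermatOfWeierstrass (-(2 • Q))).1 (tangential v') by
    obtain ⟨v', h1, h2⟩ := h
    obtain ⟨c, hc, rfl⟩ := (hasCoords_iff h1).1 hv
    rw [tangential_smul]
    exact (hasCoords_iff h2).2 ⟨c ^ 4, pow_ne_zero 4 hc, rfl⟩
  have hzero : HasCoords (fermatOfWeierstrass 0).1 (fermatVec 0 1 0) := ⟨_, rfl⟩
  rcases Q with _ | ⟨x, y, hxy⟩
  · refine ⟨_, hzero, ?_⟩
    have h0 : -(2 • (WeierstrassCurve.Affine.Point.zero : fermatWeierstrass.Point)) = 0 := by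
      change -(2 • (0 : fermatWeierstrass.Point)) = 0
      rw [nsmul_zero, neg_zero]
    rw [h0]
    refine (hasCoords_iff hzero).2 ⟨-1, by norm_num, ?_⟩
    funext i
    fin_cases i <;> simp [tangential, fermatVec]
    norm_num
  · have heq := (fermatWeierstrass_equation_iff x y).1 hxy.1
    refine ⟨_, ⟨fermatVec_one_ne_zero x y, rfl⟩, ?_⟩
    have hnegY : fermatWeierstrass.negY x y = -y := by
      simp [WeierstrassCurve.Affine.negY, fermatWeierstrass]
    by_cases hy : y = 0
    · rw [two_nsmul, WeierstrassCurve.Affine.Point.add_self_of_Y_eq (by rw [hnegY, hy, neg_zero]),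
        neg_zero]
      refine (hasCoords_iff hzero).2 ⟨36 * (36 ^ 3 + 216 * x ^ 3), ?_, ?_⟩
      · rw [hy] at heq
        rw [show x ^ 3 = 432 by linear_combination -heq]
        norm_num
      · funext i
        fin_cases i <;> simp [tangential, fermatVec, hy] <;> ring
    · have hne : y ≠ fermatWeierstrass.negY x y := fun h => hy (by
        rw [hnegY] at h
        linear_combination h / 2)
      rw [two_nsmul, WeierstrassCurve.Affine.Point.add_self_of_Y_ne' hne, neg_neg]
      refine (hasCoords_iff (v := fermatVec _ _ 1) ⟨fermatVec_one_ne_zero _ _, rfl⟩).2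
        ⟨8 * y ^ 3, mul_ne_zero (by norm_num) (pow_ne_zero 3 hy), ?_⟩
      rw [tangential_fermatVec heq hy, WeierstrassCurve.Affine.slope_of_Y_ne rfl hne, hnegY]
      congr 2 <;>
        simp [WeierstrassCurve.Affine.addX, WeierstrassCurve.Affine.negAddY, fermatWeierstrass] <;>
        ring

/-- The group isomorphism between the Fermat cubic and its Weierstrass form. -/
def fermatAddEquiv : FermatPoint ≃+ fermatWeierstrass.Point :=
  fermatEquiv.symm.addEquiv

theorem isTorsionPoint_iff (n : ℕ) (Q : fermatWeierstrass.Point) :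
    IsTorsionPoint n (fermatOfWeierstrass Q).1 ↔ n • Q = 0 := by
  have h1 : fermatAddEquiv (fermatOfWeierstrass Q) = Q := fermatEquiv.symm_apply_apply Q
  constructor
  · rintro ⟨R, hR, hn⟩
    obtain rfl := Subtype.ext hR
    have := congrArg fermatAddEquiv hn
    rwa [map_nsmul, map_zero, h1] at this
  · intro h
    refine ⟨_, rfl, fermatAddEquiv.injective ?_⟩
    rw [map_nsmul, map_zero, h1, h]

theorem fermatOfWeierstrass_eq_iff {Q Q' : fermatWeierstrass.Point} {v v' : Fin 3 → ℂ}
    (hv : HasCoords (fermatOfWeierstrass Q).1 v) (hv' : HasCoords (fermatOfWeierstrass Q').1 v') :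
    Q' = Q ↔ ∃ c : ℂ, c ≠ 0 ∧ v' = c • v := by
  rw [← hasCoords_iff hv]
  refine ⟨fun h => h ▸ hv', fun h => ?_⟩
  exact fermatOfWeierstrass_injective (Subtype.ext (hv'.eq h))

theorem three_nsmul_eq_zero_iff (Q : fermatWeierstrass.Point) {v : Fin 3 → ℂ}
    (hv : HasCoords (fermatOfWeierstrass Q).1 v) :
    3 • Q = 0 ↔ ∃ c : ℂ, c ≠ 0 ∧ tangential v = c • v := by
  rw [← fermatOfWeierstrass_eq_iff hv (hasCoords_neg_two_nsmul Q hv), neg_eq_iff_add_eq_zero,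
    ← succ_nsmul]

/-- Three tangentials amount to multiplication by (-2)³ = -8, and 9Q = 0 means -8Q = Q. -/
theorem nine_nsmul_eq_zero_iff (Q : fermatWeierstrass.Point) {v : Fin 3 → ℂ}
    (hv : HasCoords (fermatOfWeierstrass Q).1 v) :
    9 • Q = 0 ↔ ∃ c : ℂ, c ≠ 0 ∧ tangential (tangential (tangential v)) = c • v := by
  rw [← fermatOfWeierstrass_eq_iff hv (hasCoords_neg_two_nsmul _ (hasCoords_neg_two_nsmul _
    (hasCoords_neg_two_nsmul Q hv))), neg_nsmul (2 • Q), neg_neg, neg_eq_iff_add_eq_zero,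
    ← mul_nsmul, ← mul_nsmul, ← succ_nsmul]

variable {v : Fin 3 → ℂ}

/-- Off the triangle the three differences of cubes would all equal `c`, yet they sum to 0. On the
triangle one coordinate vanishes, the cubes of the others are opposite, and the tangential is
proportional to the point. -/
theorem exists_tangential_eq_smul_iff (hv0 : v ≠ 0) (hv : v 0 ^ 3 + v 1 ^ 3 + v 2 ^ 3 = 0) :
    (∃ c : ℂ, c ≠ 0 ∧ tangential v = c • v) ↔ ¬ IsGeneralFermat v := by
  constructor
  · rintro ⟨c, hc, h⟩ hg
    have h0 : v 1 ^ 3 - v 2 ^ 3 = c := mul_left_cancel₀ hg.zero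
      (by simpa [mul_comm c] using congrFun h 0)
    have h1 : v 2 ^ 3 - v 0 ^ 3 = c := mul_left_cancel₀ hg.one
      (by simpa [mul_comm c] using congrFun h 1)
    have h2 : v 0 ^ 3 - v 1 ^ 3 = c := mul_left_cancel₀ hg.two
      (by simpa [mul_comm c] using congrFun h 2)
    exact hc (by linear_combination -(h0 + h1 + h2) / 3)
  · intro hg
    have hne : ∀ a b c : ℂ, a = 0 → b = 0 → a ^ 3 + b ^ 3 + c ^ 3 = 0 → c = 0 := by
      rintro a b c rfl rfl h
      simpa using h
    have hz : ¬ (v 0 = 0 ∧ v 1 = 0 ∧ v 2 = 0) := fun h => hv0 (by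
      funext l; fin_cases l
      exacts [h.1, h.2.1, h.2.2])
    by_cases h0 : v 0 = 0
    · refine ⟨v 2 ^ 3, pow_ne_zero 3 fun h2 => hz ⟨h0, ?_, h2⟩, ?_⟩
      · exact hne _ _ _ h0 h2 (by linear_combination hv)
      · rw [h0] at hv
        funext i
        fin_cases i <;> simp [tangential, h0]
        · ring
        · linear_combination -v 2 * hv
    · by_cases h1 : v 1 = 0
      · refine ⟨v 0 ^ 3, pow_ne_zero 3 h0, ?_⟩
        rw [h1] at hv
        funext i
        fin_cases i <;> simp [tangential, h1]
        · linear_combination -v 0 * hv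
        · ring
      · have h2 : v 2 = 0 := by_contra fun h2 => hg ⟨hv, h0, h1, h2⟩
        refine ⟨v 1 ^ 3, pow_ne_zero 3 h1, ?_⟩
        rw [h2] at hv
        funext i
        fin_cases i <;> simp [tangential, h2]
        · ring
        · linear_combination -v 1 * hv

/-- It is a coordinate vector of the point -2Q, where Q is the point with coordinates `v`. -/
theorem tangential_ne_zero (hv0 : v ≠ 0) (hv : v 0 ^ 3 + v 1 ^ 3 + v 2 ^ 3 = 0) :
    tangential v ≠ 0 := by
  intro h
  obtain ⟨Q, hQ⟩ := fermatOfWeierstrass_surjective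
    ⟨Projectivization.mk ℂ v hv0, (onCurve_fermat_mk v hv0).2 hv⟩
  exact (hasCoords_neg_two_nsmul Q ⟨hv0, by rw [hQ]⟩).choose h

/-- The third tangential lies on the tangent at the second one; if it is proportional to `v`, this
incidence is `nineForm v = 0`. Conversely its i-th coordinate is v_i times a product of three
differences of cubes, and these products agree modulo the octic. -/
theorem exists_tangential_iterate_eq_smul_iff (hv : IsGeneralFermat v) :
    (∃ c : ℂ, c ≠ 0 ∧ tangential (tangential (tangential v)) = c • v) ↔ nineForm v = 0 := by
  have hv0 : v ≠ 0 := fun h => hv.zero (by rw [h]; rfl)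
  constructor
  · rintro ⟨c, hc, h⟩
    have h1 := sq_dot_tangential (tangential (tangential v))
    simp only [h, Pi.smul_apply, smul_eq_mul] at h1
    refine (mul_eq_zero.1 (?_ : c * nineForm v = 0)).resolve_left hc
    rw [nineForm]
    linear_combination h1
  · intro h
    rw [nineForm_eq hv.fermat, mul_assoc, mul_assoc, mul_eq_zero, or_iff_right
      (_root_.mul_ne_zero (by norm_num) (pow_ne_zero 3 hv.mul_ne_zero))] at h
    -- Primes denote the cubes of the first and second tangentials. The products have degree 1 + 4 +
    -- 16 = 21, so the cofactors of the octic have degree 13.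
    have key : ∀ a b c : ℂ, a + b + c = 0 → (a ^ 2 + a * b + b ^ 2) *
        ((b ^ 3 + 6 * b ^ 2 * a + 3 * b * a ^ 2 - a ^ 3) *
        (b ^ 3 - 3 * b ^ 2 * a - 6 * b * a ^ 2 - a ^ 3)) = 0 →
        ∀ a' b' c' a'' b'' c'', a' = a * (b - c) ^ 3 → b' = b * (c - a) ^ 3 →
        c' = c * (a - b) ^ 3 → a'' = a' * (b' - c') ^ 3 → b'' = b' * (c' - a') ^ 3 →
        c'' = c' * (a' - b') ^ 3 →
        (b - c) * (b' - c') * (b'' - c'') = (c - a) * (c' - a') * (c'' - a'') ∧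
        (c - a) * (c' - a') * (c'' - a'') = (a - b) * (a' - b') * (a'' - b'') := by
      rintro a b c h1 h2 _ _ _ _ _ _ rfl rfl rfl rfl rfl rfl
      obtain rfl : c = -a - b := by linear_combination h1
      constructor
      · linear_combination (9 * a ^ 13 + 144 * a ^ 12 * b + 2673 * a ^ 11 * b ^ 2 + 11493 * a ^ 10 * b ^ 3 +
          27990 * a ^ 9 * b ^ 4 + 54189 * a ^ 8 * b ^ 5 + 80649 * a ^ 7 * b ^ 6
          + 80649 * a ^ 6 * b ^ 7 + 54189 * a ^ 5 * b ^ 8 + 27990 * a ^ 4 * b ^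
          9 + 11493 * a ^ 3 * b ^ 10 + 2673 * a ^ 2 * b ^ 11 + 144 * a * b ^ 12
          + 9 * b ^ 13) * h2
      · linear_combination (-9 * a ^ 13 + 27 * a ^ 12 * b - 1647 * a ^ 11 * b ^ 2 - 10980 * a ^ 10 * b ^ 3 -
          34830 * a ^ 9 * b ^ 4 - 61884 * a ^ 8 * b ^ 5 - 59103 * a ^ 7 * b ^ 6
          - 21546 * a ^ 6 * b ^ 7 + 7695 * a ^ 5 * b ^ 8 + 6840 * a ^ 4 * b ^ 9
          - 513 * a ^ 3 * b ^ 10 - 1026 * a ^ 2 * b ^ 11 - 171 * a * b ^ 12) * h2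
    obtain ⟨h1, h2⟩ := key _ _ _ hv.fermat (by linear_combination h) (tangential v 0 ^ 3)
      (tangential v 1 ^ 3) (tangential v 2 ^ 3) (tangential (tangential v) 0 ^ 3)
      (tangential (tangential v) 1 ^ 3) (tangential (tangential v) 2 ^ 3)
      (by rw [tangential_zero, mul_pow]) (by rw [tangential_one, mul_pow])
      (by rw [tangential_two, mul_pow]) (by rw [tangential_zero, mul_pow])
      (by rw [tangential_one, mul_pow]) (by rw [tangential_two, mul_pow])
    have heq : tangential (tangential (tangential v)) =
        ((v 1 ^ 3 - v 2 ^ 3) * (tangential v 1 ^ 3 - tangential v 2 ^ 3) *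
          (tangential (tangential v) 1 ^ 3 - tangential (tangential v) 2 ^ 3)) • v := by
      funext i
      fin_cases i
      · simp only [Fin.zero_eta, Pi.smul_apply, smul_eq_mul]
        rw [tangential_zero, tangential_zero (tangential v), tangential_zero v]
        ring
      · simp only [Fin.mk_one, Pi.smul_apply, smul_eq_mul]
        rw [h1, tangential_one, tangential_one (tangential v), tangential_one v]
        ring
      · simp only [Fin.reduceFinMk, Pi.smul_apply, smul_eq_mul]
        rw [h1, h2, tangential_two, tangential_two (tangential v), tangential_two v]
        ring
    refine ⟨_, fun h0 => ?_, heq⟩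
    have ht := tangential_fermat hv.fermat
    refine tangential_ne_zero (tangential_ne_zero (tangential_ne_zero hv0 hv.fermat) ht)
      (tangential_fermat ht) ?_
    rw [heq, h0, zero_smul]

theorem isTorsionPoint_nine_and_not_three_iff (P : ProjPlane) :
    IsTorsionPoint 9 P ∧ ¬ IsTorsionPoint 3 P ↔ IsGeneralFermat P.rep ∧ nineForm P.rep = 0 := by
  by_cases hP : OnCurve fermatCubic P
  · obtain ⟨Q, hQ⟩ := fermatOfWeierstrass_surjective ⟨P, hP⟩
    obtain rfl : (fermatOfWeierstrass Q).1 = P := congrArg Subtype.val hQ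
    have hv := hasCoords_rep (fermatOfWeierstrass Q).1
    rw [isTorsionPoint_iff, isTorsionPoint_iff, nine_nsmul_eq_zero_iff Q hv,
      three_nsmul_eq_zero_iff Q hv, exists_tangential_eq_smul_iff hv.choose
      (by simpa [OnCurve, fermatCubic] using hP), not_not, and_comm]
    exact and_congr_right fun hg => exists_tangential_iterate_eq_smul_iff hg
  · refine iff_of_false ?_ fun h => hP (by simpa [OnCurve, fermatCubic] using h.1.fermat)
    rintro ⟨⟨Q, rfl, -⟩, -⟩
    exact hP Q.2
end

/-! ### Twists of T₁ and T₄ by cube roots of unity -/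

noncomputable section
open MvPolynomial

theorem exists_perm_of_eq {v v' : Fin 3 → ℂ} (c : ℂ) {a b d : Fin 3} (hab : a ≠ b) (had : a ≠ d)
    (hbd : b ≠ d) (h : v' 0 ≠ 0) (h0 : v' 0 = c * v a) (h1 : v' 1 = c * v b)
    (h2 : v' 2 = c * v d) : ∃ (σ : Equiv.Perm (Fin 3)) (c : ℂ), c ≠ 0 ∧ v' = c • (v ∘ σ) := by
  have hinj : Function.Injective ![a, b, d] := by
    intro i j hij
    fin_cases i <;> fin_cases j <;> simp_all
  refine ⟨Equiv.ofBijective _ (Finite.injective_iff_bijective.1 hinj), c, ?_, ?_⟩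
  · rintro rfl
    exact h (by rw [h0, zero_mul])
  · funext i
    fin_cases i
    exacts [h0, h1, h2]

/-- Multiply the second and third coordinates by powers of `ω`. -/
def twist (ω : ℂ) (v : Fin 3 → ℂ) (i j : Fin 3) : Fin 3 → ℂ :=
  ![v 0, v 1 * ω ^ (i : ℕ), v 2 * ω ^ (j : ℕ)]

/-- The entries of the list that arise from the first one by `twist`. -/
def twistIndexZero : Fin 3 → Fin 3 → Fin 12 := ![![0, 2, 0], ![1, 2, 2], ![1, 1, 0]]

/-- The entries of the list that arise from the fourth one by `twist`. -/
def twistIndexThree : Fin 3 → Fin 3 → Fin 12 := ![![3, 9, 10], ![11, 7, 4], ![8, 5, 6]]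

/-- The nine twists of T₁ meet only T₁, T₂, T₃ up to permutation. The scalar is the twisted
coordinate that faces the entry 1 of the listed vector; the identities hold modulo β⁶ + β³ + 1. -/
theorem exists_perm_twist_zero {α β : ℂ} (hβ : β ^ 6 + β ^ 3 + 1 = 0) (i j : Fin 3) :
    ∃ (σ : Equiv.Perm (Fin 3)) (c : ℂ), c ≠ 0 ∧ twist (β ^ 3) (typeNineList α β 0) i j =
      c • (typeNineList α β (twistIndexZero i j) ∘ σ) := by
  fin_cases i <;> fin_cases j
  · refine exists_perm_of_eq (v := typeNineList α β 0) 1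
      (a := 0) (b := 1) (d := 2) (by decide) (by decide) (by decide) (by simp [twist, typeNineList]) ?_ ?_ ?_
    · change 1 = 1 *
        (1)
      ring
    · change (β) * (β ^ 3) ^ 0 = 1 *
        (β)
      ring
    · change (β ^ 2) * (β ^ 3) ^ 0 = 1 *
        (β ^ 2)
      ring
  · refine exists_perm_of_eq (v := typeNineList α β 2) 1
      (a := 0) (b := 1) (d := 2) (by decide) (by decide) (by decide) (by simp [twist, typeNineList]) ?_ ?_ ?_
    · change 1 = 1 *
        (1)
      ring
    · change (β) * (β ^ 3) ^ 0 = 1 *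
        (β)
      ring
    · change (β ^ 2) * (β ^ 3) ^ 1 = 1 *
        (β ^ 5)
      ring
  · refine exists_perm_of_eq (v := typeNineList α β 0) ((β ^ 2) * (β ^ 3) ^ 2)
      (a := 1) (b := 2) (d := 0) (by decide) (by decide) (by decide) (by simp [twist, typeNineList]) ?_ ?_ ?_
    · change 1 = ((β ^ 2) * (β ^ 3) ^ 2) *
        (β)
      linear_combination (1 - β ^ 3) * hβ
    · change (β) * (β ^ 3) ^ 0 = ((β ^ 2) * (β ^ 3) ^ 2) *
        (β ^ 2)
      linear_combination (β - β ^ 4) * hβ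
    · change (β ^ 2) * (β ^ 3) ^ 2 = ((β ^ 2) * (β ^ 3) ^ 2) *
        (1)
      ring
  · refine exists_perm_of_eq (v := typeNineList α β 1) 1
      (a := 0) (b := 2) (d := 1) (by decide) (by decide) (by decide) (by simp [twist, typeNineList]) ?_ ?_ ?_
    · change 1 = 1 *
        (1)
      ring
    · change (β) * (β ^ 3) ^ 1 = 1 *
        (β ^ 4)
      ring
    · change (β ^ 2) * (β ^ 3) ^ 0 = 1 *
        (β ^ 2)
      ring
  · refine exists_perm_of_eq (v := typeNineList α β 2) ((β) * (β ^ 3) ^ 1)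
      (a := 2) (b := 0) (d := 1) (by decide) (by decide) (by decide) (by simp [twist, typeNineList]) ?_ ?_ ?_
    · change 1 = ((β) * (β ^ 3) ^ 1) *
        (β ^ 5)
      linear_combination (1 - β ^ 3) * hβ
    · change (β) * (β ^ 3) ^ 1 = ((β) * (β ^ 3) ^ 1) *
        (1)
      ring
    · change (β ^ 2) * (β ^ 3) ^ 1 = ((β) * (β ^ 3) ^ 1) *
        (β)
      ring
  · refine exists_perm_of_eq (v := typeNineList α β 2) ((β ^ 2) * (β ^ 3) ^ 2)
      (a := 1) (b := 2) (d := 0) (by decide) (by decide) (by decide) (by simp [twist, typeNineList]) ?_ ?_ ?_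
    · change 1 = ((β ^ 2) * (β ^ 3) ^ 2) *
        (β)
      linear_combination (1 - β ^ 3) * hβ
    · change (β) * (β ^ 3) ^ 1 = ((β ^ 2) * (β ^ 3) ^ 2) *
        (β ^ 5)
      linear_combination (β ^ 4 - β ^ 7) * hβ
    · change (β ^ 2) * (β ^ 3) ^ 2 = ((β ^ 2) * (β ^ 3) ^ 2) *
        (1)
      ring
  · refine exists_perm_of_eq (v := typeNineList α β 1) ((β) * (β ^ 3) ^ 2)
      (a := 1) (b := 0) (d := 2) (by decide) (by decide) (by decide) (by simp [twist, typeNineList]) ?_ ?_ ?_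
    · change 1 = ((β) * (β ^ 3) ^ 2) *
        (β ^ 2)
      linear_combination (1 - β ^ 3) * hβ
    · change (β) * (β ^ 3) ^ 2 = ((β) * (β ^ 3) ^ 2) *
        (1)
      ring
    · change (β ^ 2) * (β ^ 3) ^ 0 = ((β) * (β ^ 3) ^ 2) *
        (β ^ 4)
      linear_combination (β ^ 2 - β ^ 5) * hβ
  · refine exists_perm_of_eq (v := typeNineList α β 1) ((β ^ 2) * (β ^ 3) ^ 1)
      (a := 2) (b := 1) (d := 0) (by decide) (by decide) (by decide) (by simp [twist, typeNineList]) ?_ ?_ ?_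
    · change 1 = ((β ^ 2) * (β ^ 3) ^ 1) *
        (β ^ 4)
      linear_combination (1 - β ^ 3) * hβ
    · change (β) * (β ^ 3) ^ 2 = ((β ^ 2) * (β ^ 3) ^ 1) *
        (β ^ 2)
      ring
    · change (β ^ 2) * (β ^ 3) ^ 1 = ((β ^ 2) * (β ^ 3) ^ 1) *
        (1)
      ring
  · refine exists_perm_of_eq (v := typeNineList α β 0) ((β) * (β ^ 3) ^ 2)
      (a := 2) (b := 0) (d := 1) (by decide) (by decide) (by decide) (by simp [twist, typeNineList]) ?_ ?_ ?_
    · change 1 = ((β) * (β ^ 3) ^ 2) *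
        (β ^ 2)
      linear_combination (1 - β ^ 3) * hβ
    · change (β) * (β ^ 3) ^ 2 = ((β) * (β ^ 3) ^ 2) *
        (1)
      ring
    · change (β ^ 2) * (β ^ 3) ^ 2 = ((β) * (β ^ 3) ^ 2) *
        (β)
      ring

/-- The nine twists of T₄ meet T₄, …, T₁₂ once each. The scalar is the twisted coordinate that faces
the entry 3 of the listed vector, divided by 3; the identities hold modulo α³ - 3 and β⁶ + β³ + 1.
-/
theorem exists_perm_twist_three {α β : ℂ} (hα : α ^ 3 = 3) (hβ : β ^ 6 + β ^ 3 + 1 = 0) (i j : Fin 3) :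
    ∃ (σ : Equiv.Perm (Fin 3)) (c : ℂ), c ≠ 0 ∧ twist (β ^ 3) (typeNineList α β 3) i j =
      c • (typeNineList α β (twistIndexThree i j) ∘ σ) := by
  fin_cases i <;> fin_cases j
  · refine exists_perm_of_eq (v := typeNineList α β 3) 1
      (a := 0) (b := 1) (d := 2) (by decide) (by decide) (by decide) (by simp [twist, typeNineList]) ?_ ?_ ?_
    · change 3 = 1 *
        (3)
      ring
    · change (α * β * (β ^ 4 + 2 * β ^ 3 - β + 1)) * (β ^ 3) ^ 0 = 1 *
        (α * β * (β ^ 4 + 2 * β ^ 3 - β + 1))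
      ring
    · change (-α ^ 2 * (β ^ 2 + β + 1) * (β ^ 3 - β + 1)) * (β ^ 3) ^ 0 = 1 *
        (-α ^ 2 * (β ^ 2 + β + 1) * (β ^ 3 - β + 1))
      ring
  · refine exists_perm_of_eq (v := typeNineList α β 9) ((α * β * (β ^ 4 + 2 * β ^ 3 - β + 1)) * (β ^ 3) ^ 0 / 3)
      (a := 2) (b := 0) (d := 1) (by decide) (by decide) (by decide) (by simp [twist, typeNineList]) ?_ ?_ ?_
    · change 3 = ((α * β * (β ^ 4 + 2 * β ^ 3 - β + 1)) * (β ^ 3) ^ 0 / 3) *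
        (α ^ 2 * (β - 1) * (β ^ 3 + β ^ 2 + 1))
      linear_combination (1 / 3 * β - 2 / 3 * β ^ 2 + 2 / 3 * β ^ 3 + 1 / 3 * β ^ 4 - 2 / 3 * β ^
        5 + 2 / 3 * β ^ 6 + 1 / 3 * β ^ 7 - 2 / 3 * β ^ 8 - 1 / 3 * β ^ 9) * hα + (3 + β - 2
        * β ^ 2 - β ^ 3) * hβ
    · change (α * β * (β ^ 4 + 2 * β ^ 3 - β + 1)) * (β ^ 3) ^ 0 = ((α * β * (β ^ 4 + 2 * β ^ 3 - β + 1)) * (β ^ 3) ^ 0 / 3) *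
        (3)
      ring
    · change (-α ^ 2 * (β ^ 2 + β + 1) * (β ^ 3 - β + 1)) * (β ^ 3) ^ 1 = ((α * β * (β ^ 4 + 2 * β ^ 3 - β + 1)) * (β ^ 3) ^ 0 / 3) *
        (α * β * (β - 1) ^ 2 * (β ^ 2 + β + 1))
      linear_combination (-1 / 3 * α ^ 2 * β ^ 2 - 1 / 3 * α ^ 2 * β ^ 3 - 1 / 3 * α ^ 2 * β ^ 4)
        * hβ
  · refine exists_perm_of_eq (v := typeNineList α β 10) ((-α ^ 2 * (β ^ 2 + β + 1) * (β ^ 3 - β + 1)) * (β ^ 3) ^ 2 / 3)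
      (a := 1) (b := 2) (d := 0) (by decide) (by decide) (by decide) (by simp [twist, typeNineList]) ?_ ?_ ?_
    · change 3 = ((-α ^ 2 * (β ^ 2 + β + 1) * (β ^ 3 - β + 1)) * (β ^ 3) ^ 2 / 3) *
        (α * β * (β ^ 4 + 2 * β ^ 3 + 2 * β + 1))
      linear_combination (1 / 3 * β ^ 7 + 2 / 3 * β ^ 8 + 2 / 3 * β ^ 10 + 2 / 3 * β ^ 11 + β ^ 12
        + 2 / 3 * β ^ 13 + 2 / 3 * β ^ 14 + β ^ 15 + 1 / 3 * β ^ 16) * hα + (3 - 3 * β ^ 3 +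
        β ^ 7 + 2 * β ^ 8 + 3 * β ^ 9 + β ^ 10) * hβ
    · change (α * β * (β ^ 4 + 2 * β ^ 3 - β + 1)) * (β ^ 3) ^ 0 = ((-α ^ 2 * (β ^ 2 + β + 1) * (β ^ 3 - β + 1)) * (β ^ 3) ^ 2 / 3) *
        (-α ^ 2 * β ^ 2 * (β ^ 2 + β + 1))
      linear_combination (-1 / 3 * α * β ^ 8 - 1 / 3 * α * β ^ 9 - 1 / 3 * α * β ^ 10 - 1 / 3 * α
        * β ^ 12 - 2 / 3 * α * β ^ 13 - 2 / 3 * α * β ^ 14 - 1 / 3 * α * β ^ 15) * hα + (α *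
        β - α * β ^ 2 + α * β ^ 4 + 2 * α * β ^ 5 - 2 * α * β ^ 7 - 2 * α * β ^ 8 - α * β ^
        9) * hβ
    · change (-α ^ 2 * (β ^ 2 + β + 1) * (β ^ 3 - β + 1)) * (β ^ 3) ^ 2 = ((-α ^ 2 * (β ^ 2 + β + 1) * (β ^ 3 - β + 1)) * (β ^ 3) ^ 2 / 3) *
        (3)
      ring
  · refine exists_perm_of_eq (v := typeNineList α β 11) 1
      (a := 0) (b := 2) (d := 1) (by decide) (by decide) (by decide) (by simp [twist, typeNineList]) ?_ ?_ ?_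
    · change 3 = 1 *
        (3)
      ring
    · change (α * β * (β ^ 4 + 2 * β ^ 3 - β + 1)) * (β ^ 3) ^ 1 = 1 *
        (-α * β * (2 * β ^ 4 + β ^ 3 + β + 2))
      linear_combination (2 * α * β + α * β ^ 2) * hβ
    · change (-α ^ 2 * (β ^ 2 + β + 1) * (β ^ 3 - β + 1)) * (β ^ 3) ^ 0 = 1 *
        (-α ^ 2 * (β ^ 2 + β + 1) * (β ^ 3 - β + 1))
      ring
  · refine exists_perm_of_eq (v := typeNineList α β 7) ((-α ^ 2 * (β ^ 2 + β + 1) * (β ^ 3 - β + 1)) * (β ^ 3) ^ 1 / 3)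
      (a := 2) (b := 1) (d := 0) (by decide) (by decide) (by decide) (by simp [twist, typeNineList]) ?_ ?_ ?_
    · change 3 = ((-α ^ 2 * (β ^ 2 + β + 1) * (β ^ 3 - β + 1)) * (β ^ 3) ^ 1 / 3) *
        (α * β * (β ^ 4 - β ^ 3 - β - 2))
      linear_combination (-2 / 3 * β ^ 4 - 1 / 3 * β ^ 5 - 1 / 3 * β ^ 7 - 1 / 3 * β ^ 8 - β ^ 9 -
        1 / 3 * β ^ 10 - 1 / 3 * β ^ 11 + 1 / 3 * β ^ 13) * hα + (3 - 3 * β ^ 3 - 2 * β ^ 4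
        - β ^ 5 + β ^ 7) * hβ
    · change (α * β * (β ^ 4 + 2 * β ^ 3 - β + 1)) * (β ^ 3) ^ 1 = ((-α ^ 2 * (β ^ 2 + β + 1) * (β ^ 3 - β + 1)) * (β ^ 3) ^ 1 / 3) *
        (α ^ 2 * (β - 1) * (β + 1) * (β ^ 3 + β + 1))
      linear_combination (-1 / 3 * α * β ^ 3 - 1 / 3 * α * β ^ 4 + 1 / 3 * α * β ^ 5 - 1 / 3 * α *
        β ^ 7 - 1 / 3 * α * β ^ 8 + 1 / 3 * α * β ^ 10 + 1 / 3 * α * β ^ 12 + 1 / 3 * α * β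
        ^ 13) * hα + (-α * β ^ 3 + α * β ^ 6 + α * β ^ 7) * hβ
    · change (-α ^ 2 * (β ^ 2 + β + 1) * (β ^ 3 - β + 1)) * (β ^ 3) ^ 1 = ((-α ^ 2 * (β ^ 2 + β + 1) * (β ^ 3 - β + 1)) * (β ^ 3) ^ 1 / 3) *
        (3)
      ring
  · refine exists_perm_of_eq (v := typeNineList α β 4) 1
      (a := 0) (b := 1) (d := 2) (by decide) (by decide) (by decide) (by simp [twist, typeNineList]) ?_ ?_ ?_
    · change 3 = 1 *
        (3)
      ring
    · change (α * β * (β ^ 4 + 2 * β ^ 3 - β + 1)) * (β ^ 3) ^ 1 = 1 *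
        (-α * β * (2 * β ^ 4 + β ^ 3 + β + 2))
      linear_combination (2 * α * β + α * β ^ 2) * hβ
    · change (-α ^ 2 * (β ^ 2 + β + 1) * (β ^ 3 - β + 1)) * (β ^ 3) ^ 2 = 1 *
        (α ^ 2 * (β + 1) * (β - 1) ^ 2)
      linear_combination (-α ^ 2 + α ^ 2 * β + α ^ 2 * β ^ 2 - α ^ 2 * β ^ 4 - α ^ 2 * β ^ 5) * hβ
  · refine exists_perm_of_eq (v := typeNineList α β 8) ((α * β * (β ^ 4 + 2 * β ^ 3 - β + 1)) * (β ^ 3) ^ 2 / 3)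
      (a := 2) (b := 0) (d := 1) (by decide) (by decide) (by decide) (by simp [twist, typeNineList]) ?_ ?_ ?_
    · change 3 = ((α * β * (β ^ 4 + 2 * β ^ 3 - β + 1)) * (β ^ 3) ^ 2 / 3) *
        (-α ^ 2 * β * (β ^ 2 + β + 1) * (β ^ 2 - β + 1))
      linear_combination (1 / 3 * β ^ 8 - 1 / 3 * β ^ 9 + 1 / 3 * β ^ 10 + 1 / 3 * β ^ 11 + 2 / 3
        * β ^ 12 + 1 / 3 * β ^ 13 + 1 / 3 * β ^ 14 + 2 / 3 * β ^ 15 + 1 / 3 * β ^ 16) * hα +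
        (3 - 3 * β ^ 3 + β ^ 8 + 2 * β ^ 9 + β ^ 10) * hβ
    · change (α * β * (β ^ 4 + 2 * β ^ 3 - β + 1)) * (β ^ 3) ^ 2 = ((α * β * (β ^ 4 + 2 * β ^ 3 - β + 1)) * (β ^ 3) ^ 2 / 3) *
        (3)
      ring
    · change (-α ^ 2 * (β ^ 2 + β + 1) * (β ^ 3 - β + 1)) * (β ^ 3) ^ 0 = ((α * β * (β ^ 4 + 2 * β ^ 3 - β + 1)) * (β ^ 3) ^ 2 / 3) *
        (α * β * (β - 1) ^ 2 * (β ^ 2 + β + 1))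
      linear_combination (-α ^ 2 + α ^ 2 * β ^ 3 - α ^ 2 * β ^ 4 - α ^ 2 * β ^ 5 + α ^ 2 * β ^ 7 +
        2 / 3 * α ^ 2 * β ^ 8 - 1 / 3 * α ^ 2 * β ^ 9 - 1 / 3 * α ^ 2 * β ^ 10) * hβ
  · refine exists_perm_of_eq (v := typeNineList α β 5) ((-α ^ 2 * (β ^ 2 + β + 1) * (β ^ 3 - β + 1)) * (β ^ 3) ^ 1 / 3)
      (a := 1) (b := 2) (d := 0) (by decide) (by decide) (by decide) (by simp [twist, typeNineList]) ?_ ?_ ?_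
    · change 3 = ((-α ^ 2 * (β ^ 2 + β + 1) * (β ^ 3 - β + 1)) * (β ^ 3) ^ 1 / 3) *
        (α * β * (β ^ 4 - β ^ 3 - β - 2))
      linear_combination (-2 / 3 * β ^ 4 - 1 / 3 * β ^ 5 - 1 / 3 * β ^ 7 - 1 / 3 * β ^ 8 - β ^ 9 -
        1 / 3 * β ^ 10 - 1 / 3 * β ^ 11 + 1 / 3 * β ^ 13) * hα + (3 - 3 * β ^ 3 - 2 * β ^ 4
        - β ^ 5 + β ^ 7) * hβ
    · change (α * β * (β ^ 4 + 2 * β ^ 3 - β + 1)) * (β ^ 3) ^ 2 = ((-α ^ 2 * (β ^ 2 + β + 1) * (β ^ 3 - β + 1)) * (β ^ 3) ^ 1 / 3) *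
        (-α ^ 2 * β ^ 2 * (β ^ 2 + β + 1))
      linear_combination (-1 / 3 * α * β ^ 5 - 1 / 3 * α * β ^ 6 - 1 / 3 * α * β ^ 7 - 1 / 3 * α *
        β ^ 9 - 2 / 3 * α * β ^ 10 - 2 / 3 * α * β ^ 11 - 1 / 3 * α * β ^ 12) * hα + (-α * β
        ^ 5 - α * β ^ 6) * hβ
    · change (-α ^ 2 * (β ^ 2 + β + 1) * (β ^ 3 - β + 1)) * (β ^ 3) ^ 1 = ((-α ^ 2 * (β ^ 2 + β + 1) * (β ^ 3 - β + 1)) * (β ^ 3) ^ 1 / 3) *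
        (3)
      ring
  · refine exists_perm_of_eq (v := typeNineList α β 6) ((α * β * (β ^ 4 + 2 * β ^ 3 - β + 1)) * (β ^ 3) ^ 2 / 3)
      (a := 2) (b := 0) (d := 1) (by decide) (by decide) (by decide) (by simp [twist, typeNineList]) ?_ ?_ ?_
    · change 3 = ((α * β * (β ^ 4 + 2 * β ^ 3 - β + 1)) * (β ^ 3) ^ 2 / 3) *
        (-α ^ 2 * β * (β ^ 2 + β + 1) * (β ^ 2 - β + 1))
      linear_combination (1 / 3 * β ^ 8 - 1 / 3 * β ^ 9 + 1 / 3 * β ^ 10 + 1 / 3 * β ^ 11 + 2 / 3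
        * β ^ 12 + 1 / 3 * β ^ 13 + 1 / 3 * β ^ 14 + 2 / 3 * β ^ 15 + 1 / 3 * β ^ 16) * hα +
        (3 - 3 * β ^ 3 + β ^ 8 + 2 * β ^ 9 + β ^ 10) * hβ
    · change (α * β * (β ^ 4 + 2 * β ^ 3 - β + 1)) * (β ^ 3) ^ 2 = ((α * β * (β ^ 4 + 2 * β ^ 3 - β + 1)) * (β ^ 3) ^ 2 / 3) *
        (3)
      ring
    · change (-α ^ 2 * (β ^ 2 + β + 1) * (β ^ 3 - β + 1)) * (β ^ 3) ^ 2 = ((α * β * (β ^ 4 + 2 * β ^ 3 - β + 1)) * (β ^ 3) ^ 2 / 3) *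
        (α * β * (β - 1) * (β ^ 3 + 2))
      linear_combination (-α ^ 2 * β ^ 6 + 2 / 3 * α ^ 2 * β ^ 8 - 1 / 3 * α ^ 2 * β ^ 9 - 1 / 3 *
        α ^ 2 * β ^ 10) * hβ

/-- A root of `r³ - 3r² - 6r - 1`. -/
def resolventRoot (β : ℂ) : ℂ := 1 + β - β ^ 2 + 2 * β ^ 4 + β ^ 5

/-- The first coordinate of T₄ is 3, with cube 27; hence `resolventRoot β` is the value of (y/x)³ at
T₄, and its cubes are in the ratio 1 : r : -(1 + r). -/
theorem typeNineList_three_one_cube {α β : ℂ} (hα : α ^ 3 = 3) (hβ : β ^ 6 + β ^ 3 + 1 = 0) :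
    typeNineList α β 3 1 ^ 3 = 27 * resolventRoot β := by
  change (α * β * (β ^ 4 + 2 * β ^ 3 - β + 1)) ^ 3 =
    27 * (1 + β - β ^ 2 + 2 * β ^ 4 + β ^ 5)
  linear_combination (β ^ 3 - 3 * β ^ 4 + 3 * β ^ 5 + 5 * β ^ 6 - 9 * β ^ 7 + 15 * β ^ 9 - 9 * β
      ^ 11 + 5 * β ^ 12 + 12 * β ^ 13 + 6 * β ^ 14 + β ^ 15) * hα + (-27 - 27 * β + 27 * β ^ 2
      + 30 * β ^ 3 - 36 * β ^ 4 - 45 * β ^ 5 + 12 * β ^ 6 + 36 * β ^ 7 + 18 * β ^ 8 + 3 * β ^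
      9) * hβ

theorem typeNineList_three_two_cube {α β : ℂ} (hα : α ^ 3 = 3) (hβ : β ^ 6 + β ^ 3 + 1 = 0) :
    typeNineList α β 3 2 ^ 3 = -27 * (1 + resolventRoot β) := by
  change (-α ^ 2 * (β ^ 2 + β + 1) * (β ^ 3 - β + 1)) ^ 3 =
    -27 * (1 + (1 + β - β ^ 2 + 2 * β ^ 4 + β ^ 5))
  linear_combination (-3 - 9 * β ^ 4 - 9 * β ^ 5 - 9 * β ^ 8 - 18 * β ^ 9 - 9 * β ^ 10 - 3 * β ^
      12 - 9 * β ^ 13 - 9 * β ^ 14 - 3 * β ^ 15 - α ^ 3 - 3 * α ^ 3 * β ^ 4 - 3 * α ^ 3 * β ^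
      5 - 3 * α ^ 3 * β ^ 8 - 6 * α ^ 3 * β ^ 9 - 3 * α ^ 3 * β ^ 10 - α ^ 3 * β ^ 12 - 3 * α
      ^ 3 * β ^ 13 - 3 * α ^ 3 * β ^ 14 - α ^ 3 * β ^ 15) * hα + (45 + 27 * β - 27 * β ^ 2 -
      45 * β ^ 3 + 27 * β ^ 5 - 27 * β ^ 7 - 27 * β ^ 8 - 9 * β ^ 9) * hβ

theorem resolventRoot_eq {β : ℂ} (hβ : β ^ 6 + β ^ 3 + 1 = 0) :
    resolventRoot β ^ 3 - 3 * resolventRoot β ^ 2 - 6 * resolventRoot β - 1 = 0 := by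
  rw [resolventRoot]
  linear_combination (-9 - 9 * β + 9 * β ^ 2 + 10 * β ^ 3 - 12 * β ^ 4 - 15 * β ^ 5 + 4 * β ^ 6
      + 12 * β ^ 7 + 6 * β ^ 8 + β ^ 9) * hβ
end

/-! ### Completeness of the explicit list -/

noncomputable section
open MvPolynomial

/-- The binary cubic form `b³ - 3ab² - 6a²b - a³`. -/
def nineCubic (a b : ℂ) : ℂ := b ^ 3 - 3 * b ^ 2 * a - 6 * b * a ^ 2 - a ^ 3

/-- The condition for a point of the Fermat cubic, outside the coordinate triangle, to be of
type 9. -/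
structure IsNine (v : Fin 3 → ℂ) : Prop where
  general : IsGeneralFermat v
  prod : ((v 0 ^ 3) ^ 2 + v 0 ^ 3 * v 1 ^ 3 + (v 1 ^ 3) ^ 2) * nineCubic (v 1 ^ 3) (v 0 ^ 3) *
    nineCubic (v 0 ^ 3) (v 1 ^ 3) = 0

theorem isNine_iff (v : Fin 3 → ℂ) : IsNine v ↔ IsGeneralFermat v ∧ nineForm v = 0 := by
  refine ⟨fun h => ⟨h.general, ?_⟩, fun ⟨h, h'⟩ => ⟨h, ?_⟩⟩
  · rw [nineForm_eq h.general.fermat]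
    have := h.prod
    simp only [nineCubic] at this
    linear_combination -27 * (v 0 * v 1 * v 2) ^ 3 * this
  · rw [nineForm_eq h.fermat, mul_assoc, mul_assoc, mul_eq_zero, or_iff_right
      (mul_ne_zero (by norm_num) (pow_ne_zero 3 h.mul_ne_zero))] at h'
    simp only [nineCubic]
    linear_combination -h'

theorem isGeneralFermat_iff (v : Fin 3 → ℂ) :
    IsGeneralFermat v ↔ ∑ i, v i ^ 3 = 0 ∧ ∀ i, v i ≠ 0 := by
  rw [Fin.sum_univ_three, Fin.forall_fin_succ, Fin.forall_fin_two]
  exact ⟨fun h => ⟨h.1, h.2, h.3, h.4⟩, fun h => ⟨h.1, h.2.1, h.2.2.1, h.2.2.2⟩⟩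

namespace IsNine

variable {v v' : Fin 3 → ℂ}

/-- On the line a + b + c = 0 the octic is symmetric in all three cubes: eliminating c sends each
choice of two of them back to the same form. -/
theorem perm (h : IsNine v) (σ : Equiv.Perm (Fin 3)) : IsNine (v ∘ σ) := by
  obtain ⟨hs, hne⟩ := (isGeneralFermat_iff v).1 h.general
  refine ⟨(isGeneralFermat_iff _).2 ⟨?_, fun i => hne _⟩, ?_⟩
  · rw [← hs]
    exact Equiv.sum_comp σ fun i => v i ^ 3
  · have hc : v 2 ^ 3 = -v 0 ^ 3 - v 1 ^ 3 := by linear_combination h.general.fermat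
    have key : ∀ i j : Fin 3, i ≠ j → ((v i ^ 3) ^ 2 + v i ^ 3 * v j ^ 3 + (v j ^ 3) ^ 2) *
        nineCubic (v j ^ 3) (v i ^ 3) * nineCubic (v i ^ 3) (v j ^ 3) = 0 := by
      have hp := h.prod
      intro i j hij
      fin_cases i <;> fin_cases j <;> first | exact absurd rfl hij | skip
      all_goals
        simp only [Fin.zero_eta, Fin.mk_one, Fin.reduceFinMk, hc]
        simp only [nineCubic] at hp ⊢
        linear_combination hp
    exact key _ _ (σ.injective.ne (by decide))

/-- The condition involves only the cubes and is homogeneous of degree 8 in them, so it survives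
both scaling and twisting. -/
theorem of_cube_eq (h : IsNine v) {c : ℂ} (hc : c ≠ 0) (hv : ∀ i, v' i ^ 3 = c * v i ^ 3) :
    IsNine v' := by
  obtain ⟨hs, hne⟩ := (isGeneralFermat_iff v).1 h.general
  refine ⟨(isGeneralFermat_iff _).2 ⟨?_, fun i hi => ?_⟩, ?_⟩
  · simp_rw [hv, ← Finset.mul_sum, hs, mul_zero]
  · have := hv i
    rw [hi, zero_pow three_ne_zero, eq_comm] at this
    exact mul_ne_zero hc (pow_ne_zero 3 (hne i)) this
  · have hp := h.prod
    rw [hv, hv]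
    simp only [nineCubic] at hp ⊢
    linear_combination c ^ 8 * hp

theorem smul (h : IsNine v) {c : ℂ} (hc : c ≠ 0) : IsNine (c • v) :=
  h.of_cube_eq (pow_ne_zero 3 hc) fun i => by simp [mul_pow]

end IsNine

/-- `v` is proportional to a permutation of one of the listed vectors. -/
def IsListed (α β : ℂ) (v : Fin 3 → ℂ) : Prop :=
  ∃ (k : Fin 12) (σ : Equiv.Perm (Fin 3)) (c : ℂ), c ≠ 0 ∧ v = c • (typeNineList α β k ∘ σ)

section
variable {α β : ℂ} {v : Fin 3 → ℂ}

theorem IsListed.smul (h : IsListed α β v) {c : ℂ} (hc : c ≠ 0) : IsListed α β (c • v) := by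
  obtain ⟨k, σ, d, hd, rfl⟩ := h
  exact ⟨k, σ, c * d, mul_ne_zero hc hd, by rw [mul_smul]⟩

theorem IsListed.of_perm (σ : Equiv.Perm (Fin 3)) (h : IsListed α β (v ∘ σ)) :
    IsListed α β v := by
  obtain ⟨k, τ, d, hd, h⟩ := h
  refine ⟨k, τ * σ⁻¹, d, hd, ?_⟩
  funext i
  simpa using congrFun h (σ⁻¹ i)

theorem exists_eq_mul_pow {ω x y : ℂ} (hω : ω ^ 2 + ω + 1 = 0) (h : x ^ 3 = y ^ 3) :
    ∃ i : Fin 3, x = y * ω ^ (i : ℕ) := by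
  have : (x - y) * ((x - y * ω) * (x - y * ω ^ 2)) = 0 := by
    linear_combination h + (-x ^ 2 * y + x * y ^ 2 * ω - y ^ 3 * (ω - 1)) * hω
  rcases mul_eq_zero.1 this with h | h
  · exact ⟨0, by simpa using sub_eq_zero.1 h⟩
  rcases mul_eq_zero.1 h with h | h
  · exact ⟨1, by simpa using sub_eq_zero.1 h⟩
  · exact ⟨2, by simpa using sub_eq_zero.1 h⟩

theorem exists_eq_smul_twist {ω : ℂ} (hω : ω ^ 2 + ω + 1 = 0) {t : Fin 3 → ℂ} (ht : t 0 ≠ 0)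
    (hv : v 0 ≠ 0) (h1 : v 1 ^ 3 * t 0 ^ 3 = t 1 ^ 3 * v 0 ^ 3)
    (h2 : v 2 ^ 3 * t 0 ^ 3 = t 2 ^ 3 * v 0 ^ 3) :
    ∃ (c : ℂ) (i j : Fin 3), c ≠ 0 ∧ v = c • twist ω t i j := by
  obtain ⟨i, hi⟩ := exists_eq_mul_pow hω (x := v 1 * t 0) (y := t 1 * v 0)
    (by rw [mul_pow, mul_pow, h1])
  obtain ⟨j, hj⟩ := exists_eq_mul_pow hω (x := v 2 * t 0) (y := t 2 * v 0)
    (by rw [mul_pow, mul_pow, h2])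
  refine ⟨v 0 / t 0, i, j, div_ne_zero hv ht, ?_⟩
  funext l
  fin_cases l <;> simp [twist] <;> field_simp
  · rw [hi]; ring
  · rw [hj]; ring

/-- The equation of the curve forces the cubes to be 1 : β³ : β⁶ as for T₁, so the point is a twist
of T₁. -/
theorem IsListed.of_cube_eq_mul (hβ : β ^ 6 + β ^ 3 + 1 = 0) (hv : IsGeneralFermat v)
    (h : v 1 ^ 3 = β ^ 3 * v 0 ^ 3) : IsListed α β v := by
  obtain ⟨c, i, j, hc, hcv⟩ := exists_eq_smul_twist (ω := β ^ 3) (t := typeNineList α β 0)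
    (by linear_combination hβ) one_ne_zero hv.zero
    (by change _ * 1 ^ 3 = β ^ 3 * _; linear_combination h)
    (by
      change _ * 1 ^ 3 = (β ^ 2) ^ 3 * _
      linear_combination hv.fermat - h - v 0 ^ 3 * hβ)
  obtain ⟨σ, d, hd, h⟩ := exists_perm_twist_zero (α := α) hβ i j
  rw [hcv, h]
  exact IsListed.smul ⟨_, σ, d, hd, rfl⟩ hc

theorem IsListed.of_cube_eq_resolventRoot_mul (hα : α ^ 3 = 3) (hβ : β ^ 6 + β ^ 3 + 1 = 0)
    (hv : IsGeneralFermat v) (h : v 1 ^ 3 = resolventRoot β * v 0 ^ 3) : IsListed α β v := by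
  obtain ⟨c, i, j, hc, hcv⟩ := exists_eq_smul_twist (ω := β ^ 3) (t := typeNineList α β 3)
    (by linear_combination hβ) three_ne_zero hv.zero
    (by
      rw [typeNineList_three_one_cube hα hβ]
      change _ * 3 ^ 3 = _
      linear_combination 27 * h)
    (by
      rw [typeNineList_three_two_cube hα hβ]
      change _ * 3 ^ 3 = _
      linear_combination 27 * hv.fermat - 27 * h)
  obtain ⟨σ, d, hd, h⟩ := exists_perm_twist_three hα hβ i j
  rw [hcv, h]
  exact IsListed.smul ⟨_, σ, d, hd, rfl⟩ hc

/-- The roots b/a of the cubic are r, -1/(1 + r) and -(1 + r)/r. Given a + b + c = 0, the last two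
say c = r b and a = r c, so cyclic rotation of the coordinates reduces them to the first. -/
theorem IsListed.of_nineCubic_eq_zero (hα : α ^ 3 = 3) (hβ : β ^ 6 + β ^ 3 + 1 = 0)
    (hv : IsNine v) (h : nineCubic (v 0 ^ 3) (v 1 ^ 3) = 0) : IsListed α β v := by
  have hr := resolventRoot_eq hβ
  set r := resolventRoot β with hr'
  have key : (v 1 ^ 3 - r * v 0 ^ 3) *
      ((-v 0 ^ 3 - (1 + r) * v 1 ^ 3) * ((1 + r) * v 0 ^ 3 + r * v 1 ^ 3)) = 0 := by
    rw [nineCubic] at h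
    generalize v 0 ^ 3 = a at *
    generalize v 1 ^ 3 = b at *
    linear_combination -(r + r ^ 2) * h + (a ^ 2 * b + a * b ^ 2) * hr
  have hf := hv.general.fermat
  rcases mul_eq_zero.1 key with h | h
  · exact .of_cube_eq_resolventRoot_mul hα hβ hv.general (by linear_combination h)
  rcases mul_eq_zero.1 h with h | h
  · exact .of_perm (finRotate 3) (.of_cube_eq_resolventRoot_mul hα hβ (hv.perm _).general
      (by change v 2 ^ 3 = r * v 1 ^ 3; linear_combination hf + h))
  · exact .of_perm (finRotate 3)⁻¹ (.of_cube_eq_resolventRoot_mul hα hβ (hv.perm _).general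
      (by change v 0 ^ 3 = r * v 2 ^ 3; linear_combination h - r * hf))

/-- The quadratic factor has roots β³ and β⁻³, exchanged by swapping two coordinates; the same swap
exchanges the two cubic factors. -/
theorem IsNine.isListed (hα : α ^ 3 = 3) (hβ : β ^ 6 + β ^ 3 + 1 = 0) (hv : IsNine v) :
    IsListed α β v := by
  rcases mul_eq_zero.1 hv.prod with h | h
  · rcases mul_eq_zero.1 h with h | h
    · have key : (v 1 ^ 3 - β ^ 3 * v 0 ^ 3) * (v 0 ^ 3 - β ^ 3 * v 1 ^ 3) = 0 := by
        linear_combination -β ^ 3 * h + v 0 ^ 3 * v 1 ^ 3 * hβ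
      rcases mul_eq_zero.1 key with h | h
      · exact .of_cube_eq_mul hβ hv.general (by linear_combination h)
      · exact .of_perm (Equiv.swap 0 1) (.of_cube_eq_mul hβ (hv.perm _).general
          (by change v 0 ^ 3 = β ^ 3 * v 1 ^ 3; linear_combination h))
    · exact .of_perm (Equiv.swap 0 1) (.of_nineCubic_eq_zero hα hβ (hv.perm _) h)
  · exact .of_nineCubic_eq_zero hα hβ hv h

theorem IsNine.twist {ω : ℂ} (hω : ω ^ 2 + ω + 1 = 0) (hv : IsNine v) (i j : Fin 3) :
    IsNine (twist ω v i j) := by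
  have h3 : ω ^ 3 = 1 := by linear_combination (ω - 1) * hω
  refine hv.of_cube_eq one_ne_zero fun l => ?_
  have hp : ∀ n : ℕ, (ω ^ n) ^ 3 = 1 := fun n => by rw [← pow_mul, mul_comm, pow_mul, h3, one_pow]
  fin_cases l <;> simp [_root_.twist, mul_pow, hp]

theorem isNine_typeNineList_zero (hβ : β ^ 6 + β ^ 3 + 1 = 0) : IsNine (typeNineList α β 0) := by
  have h0 : β ≠ 0 := by
    rintro rfl
    norm_num at hβ
  refine ⟨⟨?_, one_ne_zero, h0, pow_ne_zero 2 h0⟩, ?_⟩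
  · change 1 ^ 3 + β ^ 3 + (β ^ 2) ^ 3 = 0
    linear_combination hβ
  · have : ((typeNineList α β 0 0 ^ 3) ^ 2 + typeNineList α β 0 0 ^ 3 * typeNineList α β 0 1 ^ 3 +
        (typeNineList α β 0 1 ^ 3) ^ 2) = 0 := by
      change (1 ^ 3) ^ 2 + 1 ^ 3 * β ^ 3 + (β ^ 3) ^ 2 = 0
      linear_combination hβ
    rw [this, zero_mul, zero_mul]

theorem isNine_typeNineList_three (hα : α ^ 3 = 3) (hβ : β ^ 6 + β ^ 3 + 1 = 0) :
    IsNine (typeNineList α β 3) := by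
  have h0 : typeNineList α β 3 0 = 3 := rfl
  have h1 := typeNineList_three_one_cube hα hβ
  have h2 := typeNineList_three_two_cube hα hβ
  have hr := resolventRoot_eq hβ
  refine ⟨⟨?_, three_ne_zero, fun h => ?_, fun h => ?_⟩, ?_⟩
  · rw [h0, h1, h2]
    ring
  · rw [h] at h1
    have : resolventRoot β = 0 := by linear_combination -h1 / 27
    norm_num [this] at hr
  · rw [h] at h2
    have : resolventRoot β = -1 := by linear_combination h2 / 27
    norm_num [this] at hr
  · have : nineCubic (typeNineList α β 3 0 ^ 3) (typeNineList α β 3 1 ^ 3) = 0 := by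
      rw [h0, h1, nineCubic]
      linear_combination 27 ^ 3 * hr
    rw [this, mul_zero]

/-- Only T₁ and T₄ need checking: the two twist tables reach all twelve indices, and the condition
is invariant under twists, permutations and scaling. -/
theorem isNine_typeNineList (hα : α ^ 3 = 3) (hβ : β ^ 6 + β ^ 3 + 1 = 0) (k : Fin 12) :
    IsNine (typeNineList α β k) := by
  have hω : (β ^ 3) ^ 2 + β ^ 3 + 1 = 0 := by linear_combination hβ
  have hk : ∀ k, (∃ i j, twistIndexZero i j = k) ∨ ∃ i j, twistIndexThree i j = k := by decide
  have key : ∀ {v w : Fin 3 → ℂ}, IsNine v →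
      (∃ (σ : Equiv.Perm (Fin 3)) (c : ℂ), c ≠ 0 ∧ v = c • (w ∘ σ)) → IsNine w := by
    rintro _ w hv ⟨σ, c, hc, rfl⟩
    have := (hv.perm σ⁻¹).smul (inv_ne_zero hc)
    convert this using 1
    funext i
    simp [hc]
  rcases hk k with ⟨i, j, rfl⟩ | ⟨i, j, rfl⟩
  · exact key ((isNine_typeNineList_zero hβ).twist hω i j) (exists_perm_twist_zero hβ i j)
  · exact key ((isNine_typeNineList_three hα hβ).twist hω i j) (exists_perm_twist_three hα hβ i j)

end
end

/-! ### Counting the points -/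

noncomputable section
open Polynomial

/-- The polynomial whose roots are the values of `(y / x) ^ 3` at the points `[x : y : z]` of
type 9. -/
def cubeRatioPoly : ℂ[X] :=
  X ^ 8 + 4 * X ^ 7 - 17 * X ^ 6 - 65 * X ^ 5 - 89 * X ^ 4 - 65 * X ^ 3 - 17 * X ^ 2 + 4 * X + 1

theorem natDegree_cubeRatioPoly : cubeRatioPoly.natDegree = 8 := by
  unfold cubeRatioPoly
  compute_degree!

theorem separable_cubeRatioPoly : cubeRatioPoly.Separable := by
  have hd : derivative cubeRatioPoly = 8 * X ^ 7 + 28 * X ^ 6 - 102 * X ^ 5 - 325 * X ^ 4 -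
      356 * X ^ 3 - 195 * X ^ 2 - 34 * X + 4 := by
    simp [cubeRatioPoly, C_ofNat]
    ring
  have hc : C (19683⁻¹ : ℂ) * 19683 = 1 := by
    rw [← C_ofNat, ← C_mul]
    norm_num
  -- Bézout cofactors of the polynomial and its derivative, with common denominator 19683 = 3⁹.
  refine ⟨C (19683⁻¹ : ℂ) * (3335 + 144462 * X + 334398 * X ^ 2 + 368768 * X ^ 3 +
    156624 * X ^ 4 - 33312 * X ^ 5 - 11104 * X ^ 6), C (19683⁻¹ : ℂ) * (4087 - 4711 * X -
    54690 * X ^ 2 - 89216 * X ^ 3 - 76705 * X ^ 4 - 25824 * X ^ 5 + 4858 * X ^ 6 +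
    1388 * X ^ 7), ?_⟩
  rw [hd, cubeRatioPoly]
  linear_combination hc

theorem card_roots_cubeRatioPoly : cubeRatioPoly.roots.toFinset.card = 8 := by
  rw [Multiset.toFinset_card_of_nodup (nodup_roots separable_cubeRatioPoly),
    ← natDegree_cubeRatioPoly]
  exact (IsAlgClosed.splits _).natDegree_eq_card_roots.symm

theorem mem_roots_cubeRatioPoly {t : ℂ} : t ∈ cubeRatioPoly.roots ↔
    t ^ 8 + 4 * t ^ 7 - 17 * t ^ 6 - 65 * t ^ 5 - 89 * t ^ 4 - 65 * t ^ 3 - 17 * t ^ 2 + 4 * t +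
      1 = 0 := by
  have h0 : cubeRatioPoly ≠ 0 := fun h => by
    have := natDegree_cubeRatioPoly
    simp [h] at this
  rw [mem_roots h0, IsRoot.def]
  simp [cubeRatioPoly]

theorem card_nthRoots_toFinset {ζ a : ℂ} {n : ℕ} (hζ : IsPrimitiveRoot ζ n) (hn : n ≠ 0)
    (ha : a ≠ 0) : (nthRoots n a).toFinset.card = n := by
  rw [Multiset.toFinset_card_of_nodup (hζ.nthRoots_nodup ha), hζ.card_nthRoots,
    if_pos (IsAlgClosed.exists_pow_nat_eq a (Nat.pos_of_ne_zero hn))]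

/-- The pairs `(y, z)` for which `[1 : y : z]` is a point of type 9. -/
def typeNinePairs : Finset (ℂ × ℂ) :=
  cubeRatioPoly.roots.toFinset.biUnion fun t =>
    (nthRoots 3 t).toFinset ×ˢ (nthRoots 3 (-1 - t)).toFinset

theorem mem_typeNinePairs {p : ℂ × ℂ} : p ∈ typeNinePairs ↔ IsNine ![1, p.1, p.2] := by
  simp only [typeNinePairs, Finset.mem_biUnion, mem_roots_cubeRatioPoly, Finset.mem_product,
    Multiset.mem_toFinset, mem_nthRoots three_pos]
  constructor
  · rintro ⟨t, ht, h1, h2⟩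
    refine ⟨⟨?_, one_ne_zero, fun (h : p.1 = 0) => ?_, fun (h : p.2 = 0) => ?_⟩, ?_⟩
    · change 1 ^ 3 + p.1 ^ 3 + p.2 ^ 3 = 0
      linear_combination h1 + h2
    · rw [h] at h1
      obtain rfl : t = 0 := by linear_combination -h1
      norm_num at ht
    · rw [h] at h2
      obtain rfl : t = -1 := by linear_combination h2
      norm_num at ht
    · change ((1 ^ 3) ^ 2 + 1 ^ 3 * p.1 ^ 3 + (p.1 ^ 3) ^ 2) * nineCubic (p.1 ^ 3) (1 ^ 3) *
        nineCubic (1 ^ 3) (p.1 ^ 3) = 0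
      rw [h1]
      simp only [nineCubic]
      linear_combination -ht
  · intro h
    have h1 : 1 ^ 3 + p.1 ^ 3 + p.2 ^ 3 = 0 := h.general.fermat
    have h2 : ((1 ^ 3) ^ 2 + 1 ^ 3 * p.1 ^ 3 + (p.1 ^ 3) ^ 2) * nineCubic (p.1 ^ 3) (1 ^ 3) *
        nineCubic (1 ^ 3) (p.1 ^ 3) = 0 := h.prod
    simp only [nineCubic] at h2
    exact ⟨p.1 ^ 3, by linear_combination -h2, rfl, by linear_combination h1⟩

/-- Eight values of t with 3 · 3 pairs of cube roots each. Neither 0 nor -1 is a root, so t and -1 -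
t each have three distinct cube roots; pairs for different t differ because t = y³. -/
theorem card_typeNinePairs {ζ : ℂ} (hζ : IsPrimitiveRoot ζ 3) : typeNinePairs.card = 72 := by
  rw [typeNinePairs, Finset.card_biUnion, Finset.sum_congr rfl (g := fun _ => 9),
    Finset.sum_const, card_roots_cubeRatioPoly]
  · rfl
  · intro t ht
    rw [Multiset.mem_toFinset, mem_roots_cubeRatioPoly] at ht
    rw [Finset.card_product, card_nthRoots_toFinset hζ three_ne_zero,
      card_nthRoots_toFinset hζ three_ne_zero]
    · intro h
      obtain rfl : t = -1 := by linear_combination -h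
      norm_num at ht
    · rintro rfl
      norm_num at ht
  · intro t _ t' _ htt
    refine Finset.disjoint_left.2 fun p hp hp' => htt ?_
    simp only [Finset.mem_product, Multiset.mem_toFinset, mem_nthRoots three_pos] at hp hp'
    rw [← hp.1, ← hp'.1]

theorem isTypeNine_iff_isNine {P : ProjPlane} {v : Fin 3 → ℂ} (hv : HasCoords P v) :
    IsTypeNine P ↔ IsNine v := by
  obtain ⟨c, hc, h⟩ := (hasCoords_iff hv).1 (hasCoords_rep P)
  rw [isTypeNine_iff, ← isNine_iff, h]
  refine ⟨fun h => ?_, fun h => h.smul hc⟩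
  simpa [hc] using h.smul (inv_ne_zero hc)

theorem ncard_isTypeNine {ζ : ℂ} (hζ : IsPrimitiveRoot ζ 3) :
    {P : ProjPlane | IsTypeNine P}.ncard = 72 := by
  have h1 : ∀ p : ℂ × ℂ, (![1, p.1, p.2] : Fin 3 → ℂ) ≠ 0 := fun p h =>
    one_ne_zero (congrFun h 0)
  let g : ℂ × ℂ → ProjPlane := fun p => Projectivization.mk ℂ _ (h1 p)
  have hgc : ∀ p, HasCoords (g p) ![1, p.1, p.2] := fun p => ⟨h1 p, rfl⟩
  have hg : Function.Injective g := by
    intro p q hpq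
    obtain ⟨c, -, hc⟩ := (hasCoords_iff (hgc p)).1 (hpq ▸ hgc q)
    obtain rfl : c = 1 := by simpa using (congrFun hc 0).symm
    exact Prod.ext (by simpa using (congrFun hc 1).symm) (by simpa using (congrFun hc 2).symm)
  have himg : {P : ProjPlane | IsTypeNine P} = g '' typeNinePairs := by
    ext P
    simp only [Set.mem_ofPred_eq, Set.mem_image, Finset.mem_coe, mem_typeNinePairs]
    constructor
    · intro hP
      -- Type-9 points have nonzero first coordinate, so all of them lie in the chart x = 1.
      have h0 := ((isTypeNine_iff_isNine (hasCoords_rep P)).1 hP).general.zero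
      have hc : HasCoords P ![1, P.rep 1 / P.rep 0, P.rep 2 / P.rep 0] :=
        (hasCoords_iff (hasCoords_rep P)).2 ⟨(P.rep 0)⁻¹, inv_ne_zero h0, by
          funext i
          fin_cases i <;> simp [h0, div_eq_inv_mul]⟩
      exact ⟨(P.rep 1 / P.rep 0, P.rep 2 / P.rep 0), (isTypeNine_iff_isNine hc).1 hP,
        (hgc (P.rep 1 / P.rep 0, P.rep 2 / P.rep 0)).eq hc⟩
    · rintro ⟨p, hp, rfl⟩
      exact (isTypeNine_iff_isNine (hgc p)).2 hp
  rw [himg, Set.ncard_image_of_injective _ hg, Set.ncard_coe_finset, card_typeNinePairs hζ]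

theorem isTypeNine_iff_exists_hasCoords {α β : ℂ} (hα : α ^ 3 = 3) (hβ : β ^ 6 + β ^ 3 + 1 = 0)
    (P : ProjPlane) : IsTypeNine P ↔
      ∃ (k : Fin 12) (σ : Equiv.Perm (Fin 3)), HasCoords P (typeNineList α β k ∘ σ) := by
  constructor
  · intro h
    obtain ⟨k, σ, c, hc, hv⟩ := ((isTypeNine_iff_isNine (hasCoords_rep P)).1 h).isListed hα hβ
    refine ⟨k, σ, (hasCoords_iff (hasCoords_rep P)).2 ⟨c⁻¹, inv_ne_zero hc, ?_⟩⟩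
    rw [hv, smul_smul, inv_mul_cancel₀ hc, one_smul]
  · rintro ⟨k, σ, h⟩
    exact (isTypeNine_iff_isNine h).2 ((isNine_typeNineList hα hβ k).perm σ)

theorem typeNineList_mem {S : Type*} [SetLike S ℂ] [SubringClass S ℂ] {K : S} {α β : ℂ}
    (hα : α ∈ K) (hβ : β ∈ K) (k : Fin 12) (i : Fin 3) : typeNineList α β k i ∈ K := by
  have hn : ∀ n : ℕ, [n.AtLeastTwo] → (OfNat.ofNat n : ℂ) ∈ K := fun n _ => ofNat_mem K n
  fin_cases k <;> fin_cases i <;>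
  · simp only [typeNineList, Fin.zero_eta, Fin.mk_one, Fin.reduceFinMk, Matrix.cons_val]
    repeat' first
      | exact hα
      | exact hβ
      | exact one_mem K
      | exact hn _
      | apply neg_mem
      | apply pow_mem
      | apply mul_mem
      | apply add_mem
      | apply sub_mem
end

/-! ### The main theorem -/

theorem mainTheorem1 (α β : ℂ) (hα : α ^ 3 = 3) (hβ : IsPrimitiveRoot β 9) :
    -- every type-9 point has homogeneous coordinates in `ℚ(α, β)`
    (∀ P : ProjPlane, IsTypeNine P →
      ∃ v : Fin 3 → ℂ, HasCoords P v ∧ ∀ i, v i ∈ IntermediateField.adjoin ℚ {α, β}) ∧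
    -- there are exactly 72 type-9 points
    {P : ProjPlane | IsTypeNine P}.ncard = 72 ∧
    -- they are the 9-torsion points that are not 3-torsion
    (∀ P : ProjPlane, IsTypeNine P ↔ IsTorsionPoint 9 P ∧ ¬ IsTorsionPoint 3 P) ∧
    -- they are the points obtained from the twelve listed ones by permuting the coordinates
    (∀ P : ProjPlane, IsTypeNine P ↔
      ∃ (k : Fin 12) (σ : Equiv.Perm (Fin 3)), HasCoords P (typeNineList α β k ∘ σ)) := by
  have hζ : IsPrimitiveRoot (β ^ 3) 3 := hβ.pow (by norm_num) (by norm_num)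
  -- From β⁹ - 1 = (β³ - 1)(β⁶ + β³ + 1), where β³ ≠ 1 by primitivity.
  have hβ' : β ^ 6 + β ^ 3 + 1 = 0 := by
    have h1 : β ^ 3 - 1 ≠ 0 := sub_ne_zero.2 (hζ.ne_one (by norm_num))
    refine (mul_eq_zero.1 ?_).resolve_left h1
    linear_combination hβ.pow_eq_one
  have hlist := isTypeNine_iff_exists_hasCoords hα hβ'
  refine ⟨fun P hP => ?_, ncard_isTypeNine hζ, fun P => ?_, hlist⟩
  · obtain ⟨k, σ, h⟩ := (hlist P).1 hP
    exact ⟨_, h, fun i => typeNineList_mem (K := IntermediateField.adjoin ℚ {α, β})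
      (IntermediateField.subset_adjoin _ _ (Set.mem_insert _ _))
      (IntermediateField.subset_adjoin _ _ (Set.mem_insert_of_mem _ rfl)) k _⟩
  · rw [isTypeNine_iff, isTorsionPoint_nine_and_not_three_iff]
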